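/- **Setting.** Let $m,n,T\ge 1$ be integers, $\kappa=\min\{m,n\}$, and consider the channel $\mathbf y=\sqrt\rho\,\mathbf H\mathbf x+\mathbf w$, where $\mathbf w\in\mathbb R^n$ has independent standard Gaussian entries and $\mathbf H\in\mathbb R^{n\times m}$ is random with an arbitrary law, which may depend on $\rho$, subject only to the power limitation $\limsup_{\rho\to\infty}\log E\|\mathbf H\|_F^2/\log\rho\le 1$. Let $\mathbf G\in\mathbb R^{m\times\kappa}$ have rank $\kappa$ and let $\mathcal R\subset\mathbb R^\kappa$ be compact and convex, with $\mathbf 0\in\mathcal R$ and non-empty interior; $\mathbf G,\mathcal R,T$ do not depend on $\rho$. At multiplexing gain $r\ge 0$ the codewords are $\mathbf x=\rho^{-rT/\kappa}\mathbf G\mathbf s$, with $\mathbf s$ uniform on $\mathbb Z^\kappa\cap\rho^{rT/\kappa}\mathcal R$; and $\mathbf s,\mathbf H,\mathbf w$ are independent. Put $\mathbf M=\rho^{1/2-rT/\kappa}\mathbf H\mathbf G$ and $\alpha=\rho^{-rT/\kappa}$, let $\mathbf R$ be upper triangular with $\mathbf R^{\mathsf T}\mathbf R=\mathbf M^{\mathsf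 T}\mathbf M+\alpha^2\mathbf I$, and let $\mathbf r=\mathbf R^{-\mathsf T}\mathbf M^{\mathsf T}\mathbf y$. *Exact decoder.* The exact MMSE-preprocessed lattice decoder outputs $\hat{\mathbf s}=\arg\min_{\mathbf s'\in\mathbb Z^\kappa}\|\mathbf r-\mathbf R\mathbf s'\|^2$, ties being resolved by a fixed rule. Let $P_L(r,\rho)=\Pr(\hat{\mathbf s}\ne\mathbf s)$. Assume that for every $r'\in[0,r]$ this decoder has a diversity gain $d_L(r')\in[0,\infty]$, that is, $P_L(r',\rho)>0$ for all large $\rho$ and $-\log P_L(r',\rho)/\log\rho\to d_L(r')$ as $\rho\to\infty$; that $d_L(r)<\infty$; and that $d_L(r-\epsilon)>d_L(r)$ for all $0<\epsilon\le r$. *LR-aided decoder.* Run the LLL algorithm (with a parameter $\delta\in(1/4,1)$) on the columns of $\mathbf R$, obtaining a unimodular $\mathbf U$; take the QR decomposition $\tilde{\mathbf Q}\tilde{\mathbf R}=\mathbf R\mathbf U$ and $\tilde{\mathbf r}=\tilde{\mathbf Q}^{\mathsf T}\mathbf r$; and run the sphere decoder with the fixed radius $\xi=\sqrt{z\log\rho}$,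 which visits at each layer $k=1,\dots,\kappa$ the $\tilde{\mathbf s}_k\in\mathbb Z^k$ with $\|\tilde{\mathbf r}_k-\tilde{\mathbf R}_k\tilde{\mathbf s}_k\|^2\le\xi^2$ (last $k$ components, lower-right $k\times k$ submatrix). The output is $\mathbf U\tilde{\mathbf s}$, with $\tilde{\mathbf s}$ the minimiser of $\|\tilde{\mathbf r}-\tilde{\mathbf R}\tilde{\mathbf s}\|^2$ among the visited $\tilde{\mathbf s}\in\mathbb Z^\kappa$ (ties among the vectors $\mathbf U\tilde{\mathbf s}$ being resolved by the same rule as in the exact decoder). The number of flops $N$ is $c_0+c_1\cdot(\text{number of LLL iterations})+c_2\cdot(\text{number of visited nodes in all layers})$, with constants $c_0,c_1,c_2$ that do not depend on $\rho$. With a timeout at $N_{\max}$ flops, the decoder declares an error if $N\ge N_{\max}$, and also if no $\tilde{\mathbf s}\in\mathbb Z^\kappa$ lies in the sphere. Let $P_e(N_{\max},\rho)$ be its error probability at multiplexing gain $r$. **Theorem 2.** Under these assumptions there is a finite $z_0\ge d_L(r)$ such that for every $z>z_0$ and all constants $c_0,c_1,c_2$ the following hold. (1) For every $x>0$ the gap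 to the exact decoder vanishes under the timeout $N_{\max}=\rho^x$: $$\lim_{\rho\to\infty}\frac{P_e(\rho^x,\rho)}{P_L(r,\rho)}=1 .$$ (2) For every $g\ge 1$, the complexity exponent required for a gap of at most $g$ is zero (subexponential complexity): the value $0$ is attained, and is the smallest possible value, of $\lim_{\rho\to\infty}\log N_{\max}(\rho)/\log\rho$ over all timeout policies $N_{\max}(\rho)\ge 1$ for which this limit exists and $\lim_{\rho\to\infty}P_e(N_{\max}(\rho),\rho)/P_L(r,\rho)$ exists and is at most $g$. -/

import Mathlib

open MeasureTheory ProbabilityTheory Filter Topology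
open scoped ENNReal Pointwise Matrix

noncomputable section

/-- The squared Euclidean norm of a real vector. -/
def sqNorm {ι : Type*} [Fintype ι] (v : ι → ℝ) : ℝ := ∑ i, v i ^ 2

/-- The real vector with the given integer coordinates. -/
def intVec {ι : Type*} (s : ι → ℤ) : ι → ℝ := fun i => (s i : ℝ)

/-! ### Columns, Gram-Schmidt coefficients and the QR decomposition -/

/-- The columns of a matrix as vectors of a Euclidean space. -/
def cols {ι : Type*} {κ : ℕ} (A : Matrix ι (Fin κ) ℝ) (j : Fin κ) : EuclideanSpace ℝ ι :=
  WithLp.toLp 2 (fun i => A i j)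

/-- The `j`-th Gram-Schmidt vector (not normalised) of the columns of `A`. -/
def gs {ι : Type*} [Fintype ι] {κ : ℕ} (A : Matrix ι (Fin κ) ℝ) (j : Fin κ) :
    EuclideanSpace ℝ ι :=
  InnerProductSpace.gramSchmidt ℝ (cols A) j

/-- The Gram-Schmidt coefficient `μ_{ij}`: the component of column `i` along the `j`-th
Gram-Schmidt vector. -/
def gsCoeff {ι : Type*} [Fintype ι] {κ : ℕ} (A : Matrix ι (Fin κ) ℝ) (i j : Fin κ) : ℝ :=
  inner ℝ (gs A j) (cols A i) / ‖gs A j‖ ^ 2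

/-- The orthogonal factor of the thin QR decomposition of `A`: its columns are the normalised
Gram-Schmidt vectors. -/
def qrQ {ι : Type*} [Fintype ι] {κ : ℕ} (A : Matrix ι (Fin κ) ℝ) : Matrix ι (Fin κ) ℝ :=
  Matrix.of fun i j => InnerProductSpace.gramSchmidtNormed ℝ (cols A) j i

/-- The upper-triangular factor of the thin QR decomposition of `A`. -/
def qrR {ι : Type*} [Fintype ι] {κ : ℕ} (A : Matrix ι (Fin κ) ℝ) :
    Matrix (Fin κ) (Fin κ) ℝ :=
  (qrQ A)ᵀ * A

/-! ### The LLL algorithm -/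

/-- A state of the LLL algorithm run on the columns of a matrix `B`: the accumulated integer
transformation `U` (the current basis is formed by the columns of `B * U`) and the working
index `k` (columns are numbered from `0`). -/
structure LLLState (κ : ℕ) where
  U : Matrix (Fin κ) (Fin κ) ℤ
  k : ℕ

/-- The current basis `B * U`. -/
def lllBasis {κ : ℕ} (B : Matrix (Fin κ) (Fin κ) ℝ) (U : Matrix (Fin κ) (Fin κ) ℤ) :
    Matrix (Fin κ) (Fin κ) ℝ :=
  B * U.map (fun a : ℤ => (a : ℝ))

/-- Subtract from column `k` the rounded multiple of column `j`. -/
def reduceCol {κ : ℕ} (B : Matrix (Fin κ) (Fin κ) ℝ) (k : Fin κ)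
    (U : Matrix (Fin κ) (Fin κ) ℤ) (j : Fin κ) : Matrix (Fin κ) (Fin κ) ℤ :=
  U.updateCol k fun i => U i k - round (gsCoeff (lllBasis B U) k j) * U i j

/-- Size reduction of column `k` against the columns `k - 1, …, 0`, in this order. -/
def sizeReduce {κ : ℕ} (B : Matrix (Fin κ) (Fin κ) ℝ) (k : Fin κ)
    (U : Matrix (Fin κ) (Fin κ) ℤ) : Matrix (Fin κ) (Fin κ) ℤ :=
  ((List.finRange κ).filter (fun j => j < k)).reverse.foldl (reduceCol B k) U

/-- One iteration of the LLL algorithm with parameter `δ`: size-reduce the working column, test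
the Lovász condition, then either advance or swap the working column with the previous one and
step back.  The algorithm has halted once `κ ≤ k`. -/
def lllStep {κ : ℕ} (δ : ℝ) (B : Matrix (Fin κ) (Fin κ) ℝ) (st : LLLState κ) : LLLState κ :=
  if h : st.k < κ then
    let i : Fin κ := ⟨st.k, h⟩
    let j : Fin κ := ⟨st.k - 1, lt_of_le_of_lt (Nat.sub_le _ _) h⟩
    let V := sizeReduce B i st.U
    let A := lllBasis B V
    if (δ - gsCoeff A i j ^ 2) * ‖gs A j‖ ^ 2 ≤ ‖gs A i‖ ^ 2 then
      ⟨V, st.k + 1⟩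
    else
      ⟨V.submatrix id (Equiv.swap i j), max (st.k - 1) 1⟩
  else st

/-- The state after `t` iterations, starting from the identity transformation and the second
column. -/
def lllRun {κ : ℕ} (δ : ℝ) (B : Matrix (Fin κ) (Fin κ) ℝ) (t : ℕ) : LLLState κ :=
  (lllStep δ B)^[t] ⟨1, 1⟩

/-- The number of iterations after which the LLL algorithm halts (`⊤` if it never does). -/
def lllIterations {κ : ℕ} (δ : ℝ) (B : Matrix (Fin κ) (Fin κ) ℝ) : ℕ∞ :=
  ⨅ t ∈ {t : ℕ | κ ≤ (lllRun δ B t).k}, (t : ℕ∞)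

/-- The integer transformation returned by the LLL algorithm. -/
def lllOutput {κ : ℕ} (δ : ℝ) (B : Matrix (Fin κ) (Fin κ) ℝ) : Matrix (Fin κ) (Fin κ) ℤ :=
  (lllRun δ B (lllIterations δ B).toNat).U

/-! ### Lattice search and sphere decoding -/

/-- The metric `‖v - A s‖²`. -/
def metric {κ : ℕ} (v : Fin κ → ℝ) (A : Matrix (Fin κ) (Fin κ) ℝ) (s : Fin κ → ℤ) : ℝ :=
  sqNorm (v - A *ᵥ intVec s)

/-- The minimisers over the set `D` of the metric `‖v - A s‖²`. -/
def argminOn {κ : ℕ} (v : Fin κ → ℝ) (A : Matrix (Fin κ) (Fin κ) ℝ) (D : Set (Fin κ → ℤ)) :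
    Set (Fin κ → ℤ) :=
  {s | s ∈ D ∧ ∀ s' ∈ D, metric v A s ≤ metric v A s'}

/-- The indices of the last `k` of `κ` components. -/
abbrev LastIdx (κ k : ℕ) : Type := {i : Fin κ // κ ≤ (i : ℕ) + k}

/-- The nodes at layer `k` that a sphere decoder of radius `ξ` visits: the integer vectors `s` of
length `k` with `‖v_k - A_k s‖² ≤ ξ²`, where `v_k` consists of the last `k` components of `v` and
`A_k` is the lower-right `k × k` submatrix of `A`. -/
def visited {κ : ℕ} (ξ : ℝ) (v : Fin κ → ℝ) (A : Matrix (Fin κ) (Fin κ) ℝ) (k : ℕ) :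
    Set (LastIdx κ k → ℤ) :=
  {s | sqNorm ((fun i : LastIdx κ k => v i) -
      A.submatrix (Subtype.val : LastIdx κ k → Fin κ) Subtype.val *ᵥ intVec s) ≤ ξ ^ 2}

/-- The total number of nodes visited by the sphere decoder, over the layers `1, …, κ`. -/
def visitedCount {κ : ℕ} (ξ : ℝ) (v : Fin κ → ℝ) (A : Matrix (Fin κ) (Fin κ) ℝ) : ℕ∞ :=
  ∑ k ∈ Finset.Icc 1 κ, (visited ξ v A k).encard

/-- The integer vectors that a sphere decoder of radius `ξ` finds (the last layer of its tree). -/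
def inSphere {κ : ℕ} (ξ : ℝ) (v : Fin κ → ℝ) (A : Matrix (Fin κ) (Fin κ) ℝ) :
    Set (Fin κ → ℤ) :=
  {s | metric v A s ≤ ξ ^ 2}

/-! ### The communication link -/

/-- A fading link `y = √ρ H x + w` with `n × m` real channel matrix `H`, one use of which
corresponds to `T` uses of the physical channel, together with a `κ`-dimensional lattice code:
a generator matrix `G` and a shaping region, both independent of `ρ`.  The law of `H` is arbitrary
and may depend on the signal-to-noise ratio `ρ`. -/
structure LatticeLink (m n κ : ℕ) where
  T : ℕ
  G : Matrix (Fin m) (Fin κ) ℝ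
  region : Set (Fin κ → ℝ)
  fading : ℝ → Measure (Fin n → Fin m → ℝ)
  T_pos : 0 < T
  G_rank : G.rank = κ
  region_compact : IsCompact region
  region_convex : Convex ℝ region
  region_zero : 0 ∈ region
  region_interior : (interior region).Nonempty
  fading_prob : ∀ ρ, IsProbabilityMeasure (fading ρ)

namespace LatticeLink

variable {m n κ : ℕ} (L : LatticeLink m n κ)

/-- The scaling exponent `rT/κ` at multiplexing gain `r`. -/
def scaleExp (r : ℝ) : ℝ := r * L.T / κ

/-- The set of symbol vectors `ℤ^κ ∩ ρ^{rT/κ} 𝓡`. -/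
def symbols (r ρ : ℝ) : Set (Fin κ → ℤ) :=
  {s | intVec s ∈ ρ ^ L.scaleExp r • L.region}

/-- The codeword `x = ρ^{-rT/κ} G s`. -/
def codeword (r ρ : ℝ) (s : Fin κ → ℤ) : Fin m → ℝ :=
  ρ ^ (-L.scaleExp r) • (L.G *ᵥ intVec s)

/-- The received vector `y = √ρ H x + w`. -/
def received (r ρ : ℝ) (s : Fin κ → ℤ) (H : Matrix (Fin n) (Fin m) ℝ) (w : Fin n → ℝ) :
    Fin n → ℝ :=
  √ρ • (H *ᵥ L.codeword r ρ s) + w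

/-- The code-channel matrix `M = ρ^{1/2 - rT/κ} H G`. -/
def codeChannel (r ρ : ℝ) (H : Matrix (Fin n) (Fin m) ℝ) : Matrix (Fin n) (Fin κ) ℝ :=
  ρ ^ (1 / 2 - L.scaleExp r) • (H * L.G)

/-- The regularisation parameter `α = ρ^{-rT/κ}`. -/
def alpha (r ρ : ℝ) : ℝ := ρ ^ (-L.scaleExp r)

/-- The MMSE feedback filter: the upper-triangular `R` with `Rᵀ R = Mᵀ M + α² I`, obtained from
the QR decomposition of the matrix `M` stacked on top of `α I`. -/
def feedback (r ρ : ℝ) (H : Matrix (Fin n) (Fin m) ℝ) : Matrix (Fin κ) (Fin κ) ℝ :=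
  qrR (Matrix.fromRows (L.codeChannel r ρ H)
    (L.alpha r ρ • (1 : Matrix (Fin κ) (Fin κ) ℝ)))

/-- The MMSE forward filter `F = R⁻ᵀ Mᵀ`. -/
def forward (r ρ : ℝ) (H : Matrix (Fin n) (Fin m) ℝ) : Matrix (Fin κ) (Fin n) ℝ :=
  ((L.feedback r ρ H)ᵀ)⁻¹ * (L.codeChannel r ρ H)ᵀ

/-- The exact MMSE-preprocessed lattice decoder: `argmin ‖F y - R s‖²` over `s ∈ ℤ^κ`, where
`tie` selects one of the minimisers. -/
def exactDecoder (tie : Set (Fin κ → ℤ) → (Fin κ → ℤ)) (r ρ : ℝ)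
    (H : Matrix (Fin n) (Fin m) ℝ) (y : Fin n → ℝ) : Fin κ → ℤ :=
  tie (argminOn (L.forward r ρ H *ᵥ y) (L.feedback r ρ H) Set.univ)

/-- The unimodular matrix produced by running LLL on the feedback filter `R`. -/
def lrTransform (δ r ρ : ℝ) (H : Matrix (Fin n) (Fin m) ℝ) : Matrix (Fin κ) (Fin κ) ℤ :=
  lllOutput δ (L.feedback r ρ H)

/-- The lattice-reduced matrix `R U`, with `U` the LLL transformation. -/
def lrBasis (δ r ρ : ℝ) (H : Matrix (Fin n) (Fin m) ℝ) : Matrix (Fin κ) (Fin κ) ℝ :=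
  lllBasis (L.feedback r ρ H) (L.lrTransform δ r ρ H)

/-- The upper-triangular factor `R̃` in the QR decomposition `Q̃ R̃ = R U`. -/
def lrR (δ r ρ : ℝ) (H : Matrix (Fin n) (Fin m) ℝ) : Matrix (Fin κ) (Fin κ) ℝ :=
  qrR (L.lrBasis δ r ρ H)

/-- The rotated observation `r̃ = Q̃ᵀ F y`. -/
def lrObs (δ r ρ : ℝ) (H : Matrix (Fin n) (Fin m) ℝ) (y : Fin n → ℝ) : Fin κ → ℝ :=
  (qrQ (L.lrBasis δ r ρ H))ᵀ *ᵥ (L.forward r ρ H *ᵥ y)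

end LatticeLink

/-- Numbers of flops: for the work that is done once per received vector (preprocessing, the
initial orthogonalisation, the final back-transformation), per iteration of the LLL algorithm, and
per node visited by the sphere decoder. -/
structure FlopCosts where
  once : ℕ
  perLLLIteration : ℕ
  perNode : ℕ

namespace LatticeLink

variable {m n κ : ℕ} (L : LatticeLink m n κ)

/-- The number of flops that the LR-aided MMSE-preprocessed lattice sphere decoder of radius `ξ`
needs in order to run to completion. -/
def flops (c : FlopCosts) (δ ξ r ρ : ℝ) (H : Matrix (Fin n) (Fin m) ℝ) (y : Fin n → ℝ) : ℕ∞ :=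
  c.once + c.perLLLIteration * lllIterations δ (L.feedback r ρ H) +
    c.perNode * visitedCount ξ (L.lrObs δ r ρ H y) (L.lrR δ r ρ H)

open Classical in
/-- The LR-aided MMSE-preprocessed lattice sphere decoder of radius `ξ` with a timeout at `N`
flops.  It declares an error (`none`) if it is interrupted, and also if the sphere contains no
lattice point; otherwise it maps the minimisers that it found back through the LLL transformation
and selects one of them by the rule `tie`. -/
def lrDecoder (c : FlopCosts) (tie : Set (Fin κ → ℤ) → (Fin κ → ℤ)) (δ ξ N r ρ : ℝ)
    (H : Matrix (Fin n) (Fin m) ℝ) (y : Fin n → ℝ) : Option (Fin κ → ℤ) :=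
  if ENNReal.ofReal N ≤ (L.flops c δ ξ r ρ H y : ℝ≥0∞) then none
  else if inSphere ξ (L.lrObs δ r ρ H y) (L.lrR δ r ρ H) = ∅ then none
  else some (tie ((fun s => L.lrTransform δ r ρ H *ᵥ s) ''
    argminOn (L.lrObs δ r ρ H y) (L.lrR δ r ρ H)
      (inSphere ξ (L.lrObs δ r ρ H y) (L.lrR δ r ρ H))))

/-- The joint law of the transmitted symbol vector (uniform), the channel matrix and the noise
(independent standard Gaussian components); the three are independent. -/
def law (r ρ : ℝ) : Measure ((Fin κ → ℤ) × (Fin n → Fin m → ℝ) × (Fin n → ℝ)) :=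
  (uniformOn (L.symbols r ρ)).prod
    ((L.fading ρ).prod (Measure.pi fun _ : Fin n => gaussianReal 0 1))

/-- The error probability of the exact MMSE-preprocessed lattice decoder. -/
def exactError (tie : Set (Fin κ → ℤ) → (Fin κ → ℤ)) (r ρ : ℝ) : ℝ :=
  (L.law r ρ).real {ω | L.exactDecoder tie r ρ ω.2.1 (L.received r ρ ω.1 ω.2.1 ω.2.2) ≠ ω.1}

/-- The error probability of the LR-aided MMSE-preprocessed lattice sphere decoder of radius `ξ`
with a timeout at `N` flops. -/
def lrError (c : FlopCosts) (tie : Set (Fin κ → ℤ) → (Fin κ → ℤ)) (δ ξ N r ρ : ℝ) : ℝ :=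
  (L.law r ρ).real
    {ω | L.lrDecoder c tie δ ξ N r ρ ω.2.1 (L.received r ρ ω.1 ω.2.1 ω.2.2) ≠ some ω.1}

/-- The channel is power limited: `E ‖H‖_F² ≤ ρ^{1 + o(1)}`. -/
def PowerLimited : Prop :=
  ∀ ε > (0 : ℝ), ∀ᶠ ρ in atTop,
    ∫⁻ H, ENNReal.ofReal (∑ i, ∑ j, H i j ^ 2) ∂(L.fading ρ) ≤ ENNReal.ofReal (ρ ^ (1 + ε))

end LatticeLink

/-- The error probability `P` has diversity gain `d`: `-log P(ρ) / log ρ → d` as `ρ → ∞`. -/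
def HasDiversityGain (P : ℝ → ℝ) (d : EReal) : Prop :=
  (∀ᶠ ρ in atTop, 0 < P ρ) ∧
    Tendsto (fun ρ => ((-Real.log (P ρ) / Real.log ρ : ℝ) : EReal)) atTop (𝓝 d)

/-- The search radius `√(z log ρ)`. -/
def searchRadius (z ρ : ℝ) : ℝ := √(z * Real.log ρ)

/-- The error probability `Pe N ρ` belongs to a decoder that is run with a timeout at `N` flops,
and `P ρ` to the baseline decoder.  This is the set of the limits `lim log N_max / log ρ`, over all
timeout policies `N_max(ρ) ≥ 1` under which the gap `lim Pe / P` exists and is at most `g`. -/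
def gapExponents (Pe : ℝ → ℝ → ℝ) (P : ℝ → ℝ) (g : ℝ) : Set ℝ :=
  {c | ∃ Nmax : ℝ → ℝ, (∀ᶠ ρ in atTop, 1 ≤ Nmax ρ) ∧
    Tendsto (fun ρ => Real.log (Nmax ρ) / Real.log ρ) atTop (𝓝 c) ∧
    ∃ g' ≤ g, Tendsto (fun ρ => Pe (Nmax ρ) ρ / P ρ) atTop (𝓝 g')}

end

/-!
If the LR-aided decoder is not interrupted and the transmitted point `s` lies in the search sphere,
then both decoders select from the same set of minimisers: the LLL transformation is a bijection of `ℤ^κ`, and the QR decomposition of a square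
matrix preserves the metric (`image_argminOn_inSphere`, `LatticeLink.lrDecoder_eq`). The error
events therefore differ only on a union of three rare events
(`LatticeLink.abs_lrError_sub_exactError_le`), and the point is that each of them is of smaller
order than the error probability `ρ ^ (-d(r) + o(1))` of the exact decoder. The tie-breaking rule is
arbitrary, so the error events need not be measurable; monotonicity and subadditivity of the outer
measure suffice.

* *Strong noise.* The residual at `s` is `Qᵀ (w, -α s)`, with `Q` the orthogonal factor of `M`
  stacked on `α I`, so its square is at most `‖w‖² + O(1)`. The Gaussian tail makes
  `‖w‖² > z log ρ - O(1)` as unlikely as any given power of `ρ⁻¹` when `z` is large; this fixes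
  `z₀`.
* *A large channel.* Markov's inequality and the power constraint handle `‖H‖² > ρ ^ A`.
* *A short lattice vector.* Lowering the multiplexing gain from `r` to `r' < r` scales the lattice
  of `R` up by a power of `ρ`. A lattice vector `R v` of length below `ρ ^ (-ε / 2)` is thus still
  short at a suitable `r'`, and then the exact decoder at `r'` errs with a probability bounded below
  (`LatticeLink.exists_mul_shortVectorEvent_le`): the noise component along `M v` and the bias
  `-α² ⟨s, v⟩` are together large enough to favour `s + v` or `s - v`. The bias is needed when `M v`
  is tiny, and it is large because a positive fraction of the symbol vectors satisfies
  `‖v‖² < |⟨s, v⟩|` (`exists_le_uniformOn_large_inner`). So short vectors have probability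
  `O(P_L(r'))`, which is `o(P_L(r))` as `d(r') > d(r)`. At `r = 0` there are none, since `α = 1`.

Outside these events the complexity is below every power of `ρ` (`LatticeLink.eventually_flops_lt`).
The LLL potential decreases geometrically with the swaps, starts below a power of `ρ`, and stays
above a power of `ρ⁻¹`, because `‖R x‖ ≥ α ‖x‖` and the Gram determinants of integer vectors are
positive integers; so there are `O(log ρ)` iterations (`lll_spec`). All Gram-Schmidt norms of the
reduced basis are at least a constant multiple of the length of its first vector, hence of
`ρ ^ (-ε / 2)`, and a triangular system with a diagonal of at least `d` has at most
`(1 + 2 ξ / d) ^ κ` integer points in a sphere of radius `ξ` (`encard_sphere_le`), which is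
`ρ ^ (O(ε))` up to logarithms. Taking `ε` small gives part (1), and a diagonal argument over
`x → 0` gives a subpolynomial timeout for part (2).
-/

/-! ### Gram-Schmidt vectors -/

section GramSchmidt

open InnerProductSpace Submodule

variable {κ : ℕ} {E : Type*} [NormedAddCommGroup E] [InnerProductSpace ℝ E]

theorem sub_gramSchmidt_mem_span (f : Fin κ → E) (n : Fin κ) :
    f n - gramSchmidt ℝ f n ∈ span ℝ (f '' Set.Iio n) := by
  rw [← span_gramSchmidt_Iio ℝ f n]
  nth_rw 1 [gramSchmidt_def'' ℝ f n]
  rw [add_sub_cancel_left]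
  exact Submodule.sum_mem _ fun i hi => smul_mem _ _ <|
    subset_span ⟨i, by simpa using hi, rfl⟩

theorem inner_gramSchmidt_eq_zero (f : Fin κ → E) {i n : Fin κ} (h : i < n) :
    inner ℝ (f i) (gramSchmidt ℝ f n) = 0 := by
  rw [real_inner_comm]; exact gramSchmidt_inv_triangular ℝ f h

theorem inner_mem_span_gramSchmidt (f : Fin κ → E) {n : Fin κ} {u : E}
    (hu : u ∈ span ℝ (f '' Set.Iio n)) : inner ℝ u (gramSchmidt ℝ f n) = 0 := by
  induction hu using span_induction with
  | mem x hx => obtain ⟨i, hi, rfl⟩ := hx; exact inner_gramSchmidt_eq_zero f hi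
  | zero => simp
  | add x y _ _ hx hy => rw [inner_add_left, hx, hy, add_zero]
  | smul a x _ hx => rw [inner_smul_left, hx, mul_zero]

/-- The `n`-th Gram-Schmidt vector is the only vector that differs from `f n` by an element of the
span of the earlier vectors and is orthogonal to all of them. -/
theorem gramSchmidt_eq_of_orthogonal (f : Fin κ → E) (n : Fin κ) (g : E)
    (h1 : f n - g ∈ span ℝ (f '' Set.Iio n)) (h2 : ∀ i < n, inner ℝ (f i) g = 0) :
    gramSchmidt ℝ f n = g := by
  have hd : g - gramSchmidt ℝ f n ∈ span ℝ (f '' Set.Iio n) := by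
    have := Submodule.sub_mem _ (sub_gramSchmidt_mem_span f n) h1
    rwa [sub_sub_sub_cancel_left] at this
  have h3 : ∀ u ∈ span ℝ (f '' Set.Iio n), inner ℝ u g = 0 := by
    intro u hu
    induction hu using span_induction with
    | mem x hx => obtain ⟨i, hi, rfl⟩ := hx; exact h2 i hi
    | zero => simp
    | add x y _ _ hx hy => rw [inner_add_left, hx, hy, add_zero]
    | smul a x _ hx => rw [inner_smul_left, hx, mul_zero]
  have h4 : inner ℝ (g - gramSchmidt ℝ f n) (g - gramSchmidt ℝ f n) = 0 := by
    rw [inner_sub_right, h3 _ hd, inner_mem_span_gramSchmidt f hd, sub_zero]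
  rw [inner_self_eq_zero, sub_eq_zero] at h4
  exact h4.symm

theorem gramSchmidt_congr (f f' : Fin κ → E) (n : Fin κ)
    (hs : span ℝ (f' '' Set.Iio n) = span ℝ (f '' Set.Iio n))
    (hn : f' n - f n ∈ span ℝ (f '' Set.Iio n)) :
    gramSchmidt ℝ f' n = gramSchmidt ℝ f n := by
  refine gramSchmidt_eq_of_orthogonal f' n _ ?_ fun i hi => ?_
  · rw [hs]
    have := Submodule.add_mem _ hn (sub_gramSchmidt_mem_span f n)
    rwa [sub_add_sub_cancel] at this
  · apply inner_mem_span_gramSchmidt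
    rw [← hs]
    exact subset_span ⟨i, hi, rfl⟩

/-- Subtracting from one vector a multiple of an earlier one leaves all Gram-Schmidt vectors
unchanged. -/
theorem gramSchmidt_update_sub_smul (f : Fin κ → E) {j k : Fin κ} (hjk : j < k) (c : ℝ) :
    gramSchmidt ℝ (Function.update f k (f k - c • f j)) = gramSchmidt ℝ f := by
  funext n
  have hj : f j = Function.update f k (f k - c • f j) j := by
    rw [Function.update_of_ne hjk.ne]
  refine gramSchmidt_congr _ _ _ (le_antisymm (span_le.2 ?_) (span_le.2 ?_)) ?_
  · rintro _ ⟨i, hi, rfl⟩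
    rcases eq_or_ne i k with rfl | hik
    · rw [Function.update_self]
      exact Submodule.sub_mem _ (subset_span ⟨i, hi, rfl⟩)
        (smul_mem _ _ (subset_span ⟨j, lt_trans hjk hi, rfl⟩))
    · rw [Function.update_of_ne hik]
      exact subset_span ⟨i, hi, rfl⟩
  · rintro _ ⟨i, hi, rfl⟩
    rcases eq_or_ne i k with rfl | hik
    · have hmem := Submodule.add_mem _
        (subset_span (R := ℝ) (Set.mem_image_of_mem (Function.update f i (f i - c • f j))
          (show i ∈ Set.Iio n from hi)))
        (smul_mem _ c (subset_span (R := ℝ)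
          (Set.mem_image_of_mem (Function.update f i (f i - c • f j))
            (show j ∈ Set.Iio n from lt_trans hjk hi))))
      rwa [← hj, Function.update_self, sub_add_cancel] at hmem
    · refine subset_span ⟨i, hi, ?_⟩
      rw [Function.update_of_ne hik]
  · rcases eq_or_ne n k with rfl | hnk
    · rw [Function.update_self, sub_sub_cancel_left]
      exact neg_mem (smul_mem _ _ (subset_span ⟨j, hjk, rfl⟩))
    · rw [Function.update_of_ne hnk, sub_self]
      exact zero_mem _

theorem inner_gramSchmidt_self (f : Fin κ → E) (a : Fin κ) :
    inner ℝ (gramSchmidt ℝ f a) (f a) = ‖gramSchmidt ℝ f a‖ ^ 2 := by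
  have := inner_mem_span_gramSchmidt f (sub_gramSchmidt_mem_span f a)
  rw [inner_sub_left, sub_eq_zero, real_inner_self_eq_norm_sq] at this
  rw [real_inner_comm, this]

theorem eq_sum_gramSchmidt (f : Fin κ → E) (hf : LinearIndependent ℝ f) (a : Fin κ) :
    f a = ∑ l, (inner ℝ (gramSchmidt ℝ f l) (f a) / ‖gramSchmidt ℝ f l‖ ^ 2) •
      gramSchmidt ℝ f l := by
  have h0 : ∀ l, a < l → inner ℝ (gramSchmidt ℝ f l) (f a) = 0 := fun l hl =>
    gramSchmidt_inv_triangular ℝ f hl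
  have hne : ‖gramSchmidt ℝ f a‖ ^ 2 ≠ 0 :=
    pow_ne_zero _ (norm_ne_zero_iff.2 (gramSchmidt_ne_zero a hf))
  rw [← Finset.sum_subset (Finset.subset_univ (Finset.Iic a))]
  · rw [← Finset.Iio_insert, Finset.sum_insert (by simp), inner_gramSchmidt_self,
      div_self hne, one_smul]
    exact gramSchmidt_def'' ℝ f a
  · intro l _ hl
    rw [h0 l (by simpa using hl), zero_div, zero_smul]

/-- The `n`-th Gram-Schmidt vector realises the distance from `f n` to the span of the earlier
vectors. -/
theorem norm_gramSchmidt_le (f : Fin κ → E) (n : Fin κ) {u : E}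
    (hu : u ∈ span ℝ (f '' Set.Iio n)) : ‖gramSchmidt ℝ f n‖ ≤ ‖f n - u‖ := by
  have hv : f n - gramSchmidt ℝ f n - u ∈ span ℝ (f '' Set.Iio n) :=
    Submodule.sub_mem _ (sub_gramSchmidt_mem_span f n) hu
  have h : ‖f n - u‖ ^ 2 = ‖f n - gramSchmidt ℝ f n - u‖ ^ 2 + ‖gramSchmidt ℝ f n‖ ^ 2 := by
    have : f n - u = (f n - gramSchmidt ℝ f n - u) + gramSchmidt ℝ f n := by abel
    rw [this, norm_add_sq_real, inner_mem_span_gramSchmidt f hv]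
    ring
  exact le_of_sq_le_sq (by nlinarith [sq_nonneg ‖f n - gramSchmidt ℝ f n - u‖]) (norm_nonneg _)

/-- Swapping two neighbouring vectors changes no other Gram-Schmidt vector. -/
theorem gramSchmidt_swap_of_ne (f : Fin κ → E) {j k n : Fin κ} (hjk : (j : ℕ) + 1 = k)
    (hj : n ≠ j) (hk : n ≠ k) :
    gramSchmidt ℝ (f ∘ Equiv.swap k j) n = gramSchmidt ℝ f n := by
  have himg : Equiv.swap k j '' Set.Iio n = Set.Iio n := by
    have hsub : Equiv.swap k j '' Set.Iio n ⊆ Set.Iio n := by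
      rintro _ ⟨i, hi, rfl⟩
      simp only [Set.mem_Iio] at hi ⊢
      rcases eq_or_ne i k with rfl | h1
      · rw [Equiv.swap_apply_left]; omega
      · rcases eq_or_ne i j with rfl | h2
        · rw [Equiv.swap_apply_right]
          have := Fin.val_ne_of_ne hk
          omega
        · rwa [Equiv.swap_apply_of_ne_of_ne h1 h2]
    refine hsub.antisymm fun i hi => ⟨Equiv.swap k j i, hsub ⟨i, hi, rfl⟩, by simp⟩
  refine gramSchmidt_congr _ _ _ ?_ ?_
  · rw [Set.image_comp, himg]
  · rw [Function.comp, Equiv.swap_apply_of_ne_of_ne hk hj, sub_self]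
    exact zero_mem _

/-- The earlier of the two new Gram-Schmidt vectors after swapping two neighbouring vectors. -/
theorem gramSchmidt_swap_left (f : Fin κ → E) {j k : Fin κ} (hjk : (j : ℕ) + 1 = k) :
    gramSchmidt ℝ (f ∘ Equiv.swap k j) j = gramSchmidt ℝ f k +
      (inner ℝ (gramSchmidt ℝ f j) (f k) / ‖gramSchmidt ℝ f j‖ ^ 2) • gramSchmidt ℝ f j := by
  have hlt : j < k := by omega
  have himg : (f ∘ Equiv.swap k j) '' Set.Iio j = f '' Set.Iio j := by
    refine Set.image_congr fun i hi => ?_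
    have hi' : i < j := hi
    rw [Function.comp, Equiv.swap_apply_of_ne_of_ne (hi'.trans hlt).ne hi'.ne]
  have hspan : ∀ i < j, gramSchmidt ℝ f i ∈ span ℝ (f '' Set.Iio j) := fun i hi => by
    rw [← span_gramSchmidt_Iio ℝ f j]; exact subset_span ⟨i, hi, rfl⟩
  refine gramSchmidt_eq_of_orthogonal _ _ _ ?_ fun i hi => ?_
  · rw [himg, Function.comp, Equiv.swap_apply_right]
    nth_rw 1 [gramSchmidt_def'' ℝ f k]
    have hI : Finset.Iio k = insert j (Finset.Iio j) := by
      ext i; simp only [Finset.mem_Iio, Finset.mem_insert]; omega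
    rw [add_sub_add_left_eq_sub, hI, Finset.sum_insert (by simp)]
    simp only [RCLike.ofReal_real_eq_id, id, add_sub_cancel_left]
    exact Submodule.sum_mem _ fun i hi => smul_mem _ _ (hspan i (by simpa using hi))
  · rw [Function.comp, Equiv.swap_apply_of_ne_of_ne (hi.trans hlt).ne hi.ne, inner_add_right,
      inner_smul_right, inner_gramSchmidt_eq_zero f hi, inner_gramSchmidt_eq_zero f (hi.trans hlt)]
    simp

theorem norm_sq_gramSchmidt_swap_left (f : Fin κ → E) {j k : Fin κ} (hjk : (j : ℕ) + 1 = k) :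
    ‖gramSchmidt ℝ (f ∘ Equiv.swap k j) j‖ ^ 2 = ‖gramSchmidt ℝ f k‖ ^ 2 +
      (inner ℝ (gramSchmidt ℝ f j) (f k) / ‖gramSchmidt ℝ f j‖ ^ 2) ^ 2 *
        ‖gramSchmidt ℝ f j‖ ^ 2 := by
  have hne : k ≠ j := by rintro rfl; omega
  rw [gramSchmidt_swap_left f hjk, norm_add_sq_real, inner_smul_right,
    gramSchmidt_orthogonal ℝ f hne, norm_smul, mul_pow, Real.norm_eq_abs, sq_abs]
  ring

/-- Swapping two neighbouring vectors preserves the product of their Gram-Schmidt norms, which is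
the area spanned by them modulo the earlier vectors. -/
theorem norm_sq_gramSchmidt_swap_mul (f : Fin κ → E) (hf : LinearIndependent ℝ f)
    {j k : Fin κ} (hjk : (j : ℕ) + 1 = k) :
    ‖gramSchmidt ℝ (f ∘ Equiv.swap k j) j‖ ^ 2 * ‖gramSchmidt ℝ (f ∘ Equiv.swap k j) k‖ ^ 2 =
      ‖gramSchmidt ℝ f j‖ ^ 2 * ‖gramSchmidt ℝ f k‖ ^ 2 := by
  have hlt : j < k := by omega
  have hleft := gramSchmidt_swap_left f hjk
  have hN := norm_sq_gramSchmidt_swap_left f hjk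
  set f' := f ∘ Equiv.swap k j with hf'
  set gj := gramSchmidt ℝ f j
  set gk := gramSchmidt ℝ f k
  set μ := inner ℝ gj (f k) / ‖gj‖ ^ 2
  set N := ‖gramSchmidt ℝ f' j‖ ^ 2
  have hj0 : 0 < ‖gj‖ ^ 2 := by
    have := norm_pos_iff.2 (gramSchmidt_ne_zero j hf); positivity
  have hk0 : 0 < ‖gk‖ ^ 2 := by
    have := norm_pos_iff.2 (gramSchmidt_ne_zero k hf); positivity
  have hN0 : 0 < N := by rw [hN]; positivity
  have hfk : inner ℝ (f k) gj = μ * ‖gj‖ ^ 2 := by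
    rw [real_inner_comm]; exact (div_mul_cancel₀ _ hj0.ne').symm
  have hfkk : inner ℝ (f k) gk = ‖gk‖ ^ 2 := by
    rw [real_inner_comm]; exact inner_gramSchmidt_self f k
  have ho : inner ℝ gj gk = 0 := gramSchmidt_orthogonal ℝ f hlt.ne
  have ho' : inner ℝ gk gj = 0 := gramSchmidt_orthogonal ℝ f hlt.ne'
  have hright : gramSchmidt ℝ f' k = gj - (μ * ‖gj‖ ^ 2 / N) • (gk + μ • gj) := by
    refine gramSchmidt_eq_of_orthogonal _ _ _ ?_ fun i hi => ?_
    · have h1 : f j - gj ∈ span ℝ (f' '' Set.Iio k) := by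
        refine (span_mono ?_) (sub_gramSchmidt_mem_span f j)
        rintro _ ⟨i, hi, rfl⟩
        have hi' : i < j := hi
        refine ⟨i, hi'.trans hlt, ?_⟩
        rw [hf', Function.comp, Equiv.swap_apply_of_ne_of_ne (hi'.trans hlt).ne hi'.ne]
      have h2 : gk + μ • gj ∈ span ℝ (f' '' Set.Iio k) := by
        rw [← hleft, ← span_gramSchmidt_Iio ℝ f' k]
        exact subset_span ⟨j, hlt, rfl⟩
      have h3 : f' k - (gj - (μ * ‖gj‖ ^ 2 / N) • (gk + μ • gj)) =
          (f j - gj) + (μ * ‖gj‖ ^ 2 / N) • (gk + μ • gj) := by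
        rw [hf', Function.comp, Equiv.swap_apply_left]; abel
      rw [h3]
      exact Submodule.add_mem _ h1 (smul_mem _ _ h2)
    · have hi' : i = j ∨ i < j := by omega
      rcases hi' with rfl | hi'
      · rw [hf', Function.comp, Equiv.swap_apply_right, inner_sub_right, inner_smul_right,
          inner_add_right, inner_smul_right, hfk, hfkk]
        have : ‖gk‖ ^ 2 + μ * (μ * ‖gj‖ ^ 2) = N := by rw [hN]; ring
        rw [this]; field_simp; ring
      · rw [hf', Function.comp, Equiv.swap_apply_of_ne_of_ne hi.ne hi'.ne, inner_sub_right,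
          inner_smul_right, inner_add_right, inner_smul_right,
          inner_gramSchmidt_eq_zero f hi', inner_gramSchmidt_eq_zero f hi]
        simp
  have hnorm : ‖gramSchmidt ℝ f' k‖ ^ 2 =
      ‖gj‖ ^ 2 - 2 * (μ * ‖gj‖ ^ 2 / N) * (μ * ‖gj‖ ^ 2) + (μ * ‖gj‖ ^ 2 / N) ^ 2 * N := by
    rw [hright, norm_sub_sq_real, inner_smul_right, inner_add_right, inner_smul_right, ho,
      real_inner_self_eq_norm_sq, norm_smul, mul_pow, Real.norm_eq_abs, sq_abs, ← hleft]
    simp only [N]; ring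
  rw [hnorm]
  have : N * (‖gj‖ ^ 2 - 2 * (μ * ‖gj‖ ^ 2 / N) * (μ * ‖gj‖ ^ 2) +
      (μ * ‖gj‖ ^ 2 / N) ^ 2 * N) = ‖gj‖ ^ 2 * (N - μ ^ 2 * ‖gj‖ ^ 2) := by
    field_simp; ring
  rw [this, hN]; ring

end GramSchmidt

/-! ### The QR decomposition -/

section QR

open InnerProductSpace

theorem inner_toLp_eq_dotProduct {ι : Type*} [Fintype ι] (x y : ι → ℝ) :
    inner ℝ (WithLp.toLp 2 x : EuclideanSpace ℝ ι) (WithLp.toLp 2 y) = x ⬝ᵥ y := by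
  simp [PiLp.inner_apply, dotProduct, mul_comm]

theorem sqNorm_eq_dotProduct {ι : Type*} [Fintype ι] (x : ι → ℝ) : sqNorm x = x ⬝ᵥ x := by
  simp [sqNorm, dotProduct, sq]

theorem norm_toLp_sq {ι : Type*} [Fintype ι] (x : ι → ℝ) :
    ‖(WithLp.toLp 2 x : EuclideanSpace ℝ ι)‖ ^ 2 = sqNorm x := by
  rw [← real_inner_self_eq_norm_sq, inner_toLp_eq_dotProduct, sqNorm_eq_dotProduct]

theorem sqNorm_nonneg {ι : Type*} [Fintype ι] (x : ι → ℝ) : 0 ≤ sqNorm x :=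
  Finset.sum_nonneg fun _ _ => sq_nonneg _

theorem sq_le_sqNorm {ι : Type*} [Fintype ι] (x : ι → ℝ) (i : ι) : x i ^ 2 ≤ sqNorm x :=
  Finset.single_le_sum (f := fun i => x i ^ 2) (fun _ _ => sq_nonneg _) (Finset.mem_univ i)

theorem sqNorm_smul {ι : Type*} [Fintype ι] (c : ℝ) (x : ι → ℝ) :
    sqNorm (c • x) = c ^ 2 * sqNorm x := by
  simp [sqNorm, mul_pow, Finset.mul_sum]

variable {ι : Type*} [Fintype ι] {κ : ℕ}

theorem linearIndependent_cols {ι : Type*} {A : Matrix ι (Fin κ) ℝ} (h : ∀ x, A *ᵥ x = 0 → x = 0) :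
    LinearIndependent ℝ (cols A) := by
  rw [Fintype.linearIndependent_iff]
  intro g hg
  have : A *ᵥ g = 0 := by
    funext i
    have := congrArg (fun v : EuclideanSpace ℝ ι => v i) hg
    simpa [cols, Matrix.mulVec, dotProduct, mul_comm] using this
  exact fun i => congrFun (h g this) i

theorem linearIndependent_cols_of_det_ne_zero {A : Matrix (Fin κ) (Fin κ) ℝ} (h : A.det ≠ 0) :
    LinearIndependent ℝ (cols A) :=
  linearIndependent_cols fun _ hx => Matrix.eq_zero_of_mulVec_eq_zero h hx

theorem gs_ne_zero {A : Matrix ι (Fin κ) ℝ} (h : LinearIndependent ℝ (cols A)) (j : Fin κ) :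
    gs A j ≠ 0 := gramSchmidt_ne_zero j h

theorem norm_sq_gs_pos {A : Matrix ι (Fin κ) ℝ} (h : LinearIndependent ℝ (cols A)) (j : Fin κ) :
    0 < ‖gs A j‖ ^ 2 := pow_pos (norm_pos_iff.2 (gs_ne_zero h j)) 2

theorem norm_sq_gs_le (A : Matrix ι (Fin κ) ℝ) (j : Fin κ) :
    ‖gs A j‖ ^ 2 ≤ sqNorm (A *ᵥ Pi.single j 1) := by
  have h := norm_gramSchmidt_le (cols A) j (u := 0) (Submodule.zero_mem _)
  rw [sub_zero] at h
  have : sqNorm (A *ᵥ Pi.single j 1) = ‖cols A j‖ ^ 2 := by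
    rw [cols, norm_toLp_sq, Matrix.mulVec_single_one]; rfl
  rw [this]
  exact pow_le_pow_left₀ (norm_nonneg _) h 2

theorem qrQ_transpose_mul_self {A : Matrix ι (Fin κ) ℝ} (h : LinearIndependent ℝ (cols A)) :
    (qrQ A)ᵀ * qrQ A = 1 := by
  ext i j
  have := orthonormal_iff_ite.1 (gramSchmidtNormed_orthonormal h) i j
  rw [Matrix.one_apply, ← this, PiLp.inner_apply, Matrix.mul_apply]
  simp [qrQ, mul_comm]

theorem qrR_apply (A : Matrix ι (Fin κ) ℝ) (i j : Fin κ) :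
    qrR A i j = ‖gs A i‖⁻¹ * inner ℝ (gs A i) (cols A j) := by
  have : qrR A i j = inner ℝ (gramSchmidtNormed ℝ (cols A) i) (cols A j) := by
    rw [PiLp.inner_apply, qrR, Matrix.mul_apply]
    simp [qrQ, cols, mul_comm]
  rw [this, gramSchmidtNormed, inner_smul_left]
  simp [gs]

theorem qrR_apply_of_lt (A : Matrix ι (Fin κ) ℝ) {i j : Fin κ} (h : j < i) : qrR A i j = 0 := by
  rw [qrR_apply, gs, gramSchmidt_inv_triangular ℝ _ h, mul_zero]

theorem qrR_apply_self {A : Matrix ι (Fin κ) ℝ} (h : LinearIndependent ℝ (cols A)) (j : Fin κ) :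
    qrR A j j = ‖gs A j‖ := by
  have h0 := norm_ne_zero_iff.2 (gs_ne_zero h j)
  rw [qrR_apply, gs, inner_gramSchmidt_self]
  rw [gs] at h0
  field_simp

theorem qrQ_mul_qrR {A : Matrix ι (Fin κ) ℝ} (h : LinearIndependent ℝ (cols A)) :
    qrQ A * qrR A = A := by
  ext l j
  have h1 := congrArg (fun v : EuclideanSpace ℝ ι => v l) (eq_sum_gramSchmidt (cols A) h j)
  simp only [WithLp.ofLp_sum, Finset.sum_apply] at h1
  rw [Matrix.mul_apply]
  refine Eq.trans ?_ h1.symm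
  refine Finset.sum_congr rfl fun i _ => ?_
  rw [qrR_apply]
  simp only [qrQ, gramSchmidtNormed, Matrix.of_apply, gs, PiLp.smul_apply, smul_eq_mul,
    RCLike.ofReal_real_eq_id, id]
  ring

theorem qrR_transpose_mul_self {A : Matrix ι (Fin κ) ℝ} (h : LinearIndependent ℝ (cols A)) :
    (qrR A)ᵀ * qrR A = Aᵀ * A := by
  have h1 : Aᵀ * A = (qrQ A * qrR A)ᵀ * (qrQ A * qrR A) := by rw [qrQ_mul_qrR h]
  rw [h1, Matrix.transpose_mul, Matrix.mul_assoc, ← Matrix.mul_assoc (qrQ A)ᵀ,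
    qrQ_transpose_mul_self h, Matrix.one_mul]

theorem det_qrR_ne_zero {A : Matrix ι (Fin κ) ℝ} (h : LinearIndependent ℝ (cols A)) :
    (qrR A).det ≠ 0 := by
  have hT : (qrR A).IsUpperTriangular := fun i j hij => qrR_apply_of_lt A hij
  rw [Matrix.det_of_isUpperTriangular hT]
  refine Finset.prod_ne_zero_iff.2 fun j _ => ?_
  rw [qrR_apply_self h]
  exact norm_ne_zero_iff.2 (gs_ne_zero h j)

/-- Projecting onto an orthonormal system does not increase the norm. -/
theorem sqNorm_transpose_mulVec_le {Q : Matrix ι (Fin κ) ℝ} (hQ : Qᵀ * Q = 1) (x : ι → ℝ) :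
    sqNorm (Qᵀ *ᵥ x) ≤ sqNorm x := by
  have h := sqNorm_nonneg (x - Q *ᵥ (Qᵀ *ᵥ x))
  have h1 : (Q *ᵥ (Qᵀ *ᵥ x)) ⬝ᵥ (Q *ᵥ (Qᵀ *ᵥ x)) = (Qᵀ *ᵥ x) ⬝ᵥ (Qᵀ *ᵥ x) := by
    rw [Matrix.dotProduct_mulVec, ← Matrix.mulVec_transpose, Matrix.mulVec_mulVec, hQ,
      Matrix.one_mulVec]
  have h2 : x ⬝ᵥ (Q *ᵥ (Qᵀ *ᵥ x)) = (Qᵀ *ᵥ x) ⬝ᵥ (Qᵀ *ᵥ x) := by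
    rw [Matrix.dotProduct_mulVec, ← Matrix.mulVec_transpose]
  rw [sqNorm_eq_dotProduct, sub_dotProduct, dotProduct_sub, dotProduct_sub, h1,
    dotProduct_comm (Q *ᵥ _) x, h2] at h
  rw [sqNorm_eq_dotProduct, sqNorm_eq_dotProduct]
  linarith

theorem sqNorm_mulVec_of_orthogonal {Q : Matrix ι (Fin κ) ℝ} (hQ : Qᵀ * Q = 1) (x : Fin κ → ℝ) :
    sqNorm (Q *ᵥ x) = sqNorm x := by
  rw [sqNorm_eq_dotProduct, sqNorm_eq_dotProduct, Matrix.dotProduct_mulVec,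
    ← Matrix.mulVec_transpose, Matrix.mulVec_mulVec, hQ, Matrix.one_mulVec]

end QR

/-! ### A lower bound for the Gram-Schmidt volumes of a lattice basis -/

section Potential

open InnerProductSpace Submodule

variable {κ : ℕ}

/-- The volume of the parallelepiped spanned by the first columns of an integer matrix is at least
one, because its square is a positive integer: the Gram determinant of these columns. -/
theorem one_le_prod_norm_sq_gs (V : Matrix (Fin κ) (Fin κ) ℤ)
    (h : LinearIndependent ℝ (cols (V.map (fun a : ℤ => (a : ℝ))))) (i : Fin κ) :
    1 ≤ ∏ j ∈ Finset.Iic i, ‖gs (V.map (fun a : ℤ => (a : ℝ))) j‖ ^ 2 := by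
  set A : Matrix (Fin κ) (Fin κ) ℝ := V.map (fun a : ℤ => (a : ℝ)) with hA
  let I := {j : Fin κ // j ≤ i}
  let W : Matrix I I ℤ := Matrix.of fun a b => ∑ l, V l a * V l b
  let N : Matrix I I ℝ := Matrix.of fun l a => gsCoeff A a l
  let D : Matrix I I ℝ := Matrix.diagonal fun l => ‖gs A l‖ ^ 2
  have hco : ∀ l a : Fin κ, a < l → gsCoeff A a l = 0 := fun l a hl => by
    rw [gsCoeff, gs, gramSchmidt_inv_triangular ℝ _ hl, zero_div]
  have hW : W.map (fun a : ℤ => (a : ℝ)) = Nᵀ * D * N := by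
    ext a b
    have h1 : (W.map (fun a : ℤ => (a : ℝ))) a b = inner ℝ (cols A a) (cols A b) := by
      rw [cols, cols, inner_toLp_eq_dotProduct]
      simp [W, dotProduct, hA]
    have h2 : inner ℝ (cols A a) (cols A b) =
        ∑ l, gsCoeff A a l * (‖gs A l‖ ^ 2 * gsCoeff A b l) := by
      conv_lhs => rw [eq_sum_gramSchmidt (cols A) h (a : Fin κ)]
      rw [sum_inner]
      refine Finset.sum_congr rfl fun l _ => ?_
      have h0 := (norm_sq_gs_pos h l).ne'
      rw [inner_smul_left]
      simp only [conj_trivial, gsCoeff]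
      congr 1
      rw [mul_div_cancel₀ _ h0]; rfl
    rw [h1, h2, Matrix.mul_apply]
    have h3 : ∑ l, gsCoeff A a l * (‖gs A l‖ ^ 2 * gsCoeff A b l) =
        ∑ l ∈ Finset.univ.filter (fun l => l ≤ i),
          gsCoeff A a l * (‖gs A l‖ ^ 2 * gsCoeff A b l) := by
      refine (Finset.sum_subset (Finset.subset_univ _) fun l _ hl => ?_).symm
      have hl' : i < l := by simpa using hl
      rw [hco l a (lt_of_le_of_lt a.2 hl'), zero_mul]
    rw [h3, Finset.sum_subtype (p := fun l => l ≤ i) _ (by simp)]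
    refine Finset.sum_congr rfl fun l _ => ?_
    simp only [D, Matrix.mul_diagonal, Matrix.transpose_apply, N, Matrix.of_apply]
    ring
  have hN : N.det = 1 := by
    have hT : N.IsUpperTriangular := fun l a hal => hco _ _ hal
    rw [Matrix.det_of_isUpperTriangular hT]
    refine Finset.prod_eq_one fun j _ => ?_
    simp only [N, Matrix.of_apply, gsCoeff]
    rw [gs, inner_gramSchmidt_self, div_self]
    exact (norm_sq_gs_pos h j).ne'
  have hdet : ((W.det : ℤ) : ℝ) = ∏ j ∈ Finset.Iic i, ‖gs A j‖ ^ 2 := by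
    have h1 : ((W.det : ℤ) : ℝ) = (W.map (fun a : ℤ => (a : ℝ))).det :=
      RingHom.map_det (Int.castRingHom ℝ) W
    rw [h1, hW, Matrix.det_mul, Matrix.det_mul, Matrix.det_transpose, hN, Matrix.det_diagonal,
      Finset.prod_subtype (p := fun l => l ≤ i) _ (by simp)]
    ring
  have hpos : (0 : ℝ) < ∏ j ∈ Finset.Iic i, ‖gs A j‖ ^ 2 :=
    Finset.prod_pos fun j _ => norm_sq_gs_pos h j
  rw [← hdet] at hpos ⊢
  exact_mod_cast hpos

/-- A linear map that stretches all vectors stretches all Gram-Schmidt vectors, which are distances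
to subspaces. -/
theorem norm_gs_mul_ge (B V : Matrix (Fin κ) (Fin κ) ℝ) {c : ℝ}
    (hB : ∀ x, c * sqNorm x ≤ sqNorm (B *ᵥ x)) (hc : 0 ≤ c) (j : Fin κ) :
    c * ‖gs V j‖ ^ 2 ≤ ‖gs (B * V) j‖ ^ 2 := by
  let Φ : EuclideanSpace ℝ (Fin κ) →ₗ[ℝ] EuclideanSpace ℝ (Fin κ) := Matrix.toEuclideanLin B
  have hΦ : cols (B * V) = Φ ∘ cols V := by
    funext a
    simp only [Φ, Function.comp, cols, Matrix.toLpLin_apply]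
    rfl
  have hΦn : ∀ x, c * ‖x‖ ^ 2 ≤ ‖Φ x‖ ^ 2 := by
    intro x
    have h1 : ‖x‖ ^ 2 = sqNorm x.ofLp := norm_toLp_sq x.ofLp
    have h2 : ‖Φ x‖ ^ 2 = sqNorm (B *ᵥ x.ofLp) := by
      rw [← norm_toLp_sq]; rfl
    rw [h1, h2]; exact hB _
  have hm := sub_gramSchmidt_mem_span (cols (B * V)) j
  rw [hΦ, Set.image_comp, ← Submodule.map_span] at hm
  obtain ⟨u, hu, hue⟩ := hm
  have : gs (B * V) j = Φ (cols V j - u) := by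
    rw [map_sub, hue, gs, hΦ]; simp
  rw [this]
  refine le_trans ?_ (hΦn _)
  exact mul_le_mul_of_nonneg_left
    (pow_le_pow_left₀ (norm_nonneg _) (norm_gramSchmidt_le _ _ hu) 2) hc

/-- The LLL potential of a basis: the product of the squared volumes spanned by its initial
segments. -/
noncomputable def lllPotential (A : Matrix (Fin κ) (Fin κ) ℝ) : ℝ :=
  ∏ j, (‖gs A j‖ ^ 2) ^ (κ - (j : ℕ))

theorem lllPotential_eq_prod (A : Matrix (Fin κ) (Fin κ) ℝ) :
    lllPotential A = ∏ i, ∏ j ∈ Finset.Iic i, ‖gs A j‖ ^ 2 := by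
  rw [Finset.prod_comm' (t' := Finset.univ) (s' := fun j => Finset.Ici j) (by simp)]
  refine Finset.prod_congr rfl fun j _ => ?_
  rw [Finset.prod_const, Fin.card_Ici]

theorem lllPotential_nonneg (A : Matrix (Fin κ) (Fin κ) ℝ) : 0 ≤ lllPotential A :=
  Finset.prod_nonneg fun _ _ => by positivity

theorem lllPotential_le (A : Matrix (Fin κ) (Fin κ) ℝ) {X : ℝ} (hX : 1 ≤ X)
    (h : ∀ j, ‖gs A j‖ ^ 2 ≤ X) : lllPotential A ≤ X ^ (κ * κ) := by
  have : X ^ (κ * κ) = ∏ _j : Fin κ, X ^ κ := by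
    rw [Finset.prod_const, Finset.card_univ, Fintype.card_fin, ← pow_mul]
  rw [this]
  refine Finset.prod_le_prod (fun _ _ => by positivity) fun j _ => ?_
  exact (pow_le_pow_left₀ (by positivity) (h j) _).trans
    (pow_le_pow_right₀ hX (Nat.sub_le _ _))

theorem lllPotential_ge (B : Matrix (Fin κ) (Fin κ) ℝ) (U : Matrix (Fin κ) (Fin κ) ℤ)
    (hU : IsUnit U.det) {c : ℝ} (hc : 0 ≤ c) (hc1 : c ≤ 1)
    (hB : ∀ x, c * sqNorm x ≤ sqNorm (B *ᵥ x)) :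
    c ^ (κ * κ) ≤ lllPotential (lllBasis B U) := by
  have hli : LinearIndependent ℝ (cols (U.map (fun a : ℤ => (a : ℝ)))) := by
    apply linearIndependent_cols_of_det_ne_zero
    have h1 : ((U.det : ℤ) : ℝ) = (U.map (fun a : ℤ => (a : ℝ))).det :=
      RingHom.map_det (Int.castRingHom ℝ) U
    rw [← h1]
    exact_mod_cast hU.ne_zero
  have : c ^ (κ * κ) = ∏ _j : Fin κ, c ^ κ := by
    rw [Finset.prod_const, Finset.card_univ, Fintype.card_fin, ← pow_mul]
  rw [lllPotential_eq_prod, this]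
  refine Finset.prod_le_prod (fun _ _ => by positivity) fun i _ => ?_
  calc c ^ κ ≤ c ^ (Finset.Iic i).card := by
        rw [Fin.card_Iic]; exact pow_le_pow_of_le_one hc hc1 (by omega)
    _ ≤ c ^ (Finset.Iic i).card *
          ∏ j ∈ Finset.Iic i, ‖gs (U.map (fun a : ℤ => (a : ℝ))) j‖ ^ 2 :=
        le_mul_of_one_le_right (by positivity) (one_le_prod_norm_sq_gs U hli i)
    _ = ∏ j ∈ Finset.Iic i, c * ‖gs (U.map (fun a : ℤ => (a : ℝ))) j‖ ^ 2 := by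
        rw [Finset.prod_mul_distrib, Finset.prod_const]
    _ ≤ _ := Finset.prod_le_prod (fun _ _ => by positivity) fun j _ =>
        norm_gs_mul_ge B _ hB hc j

end Potential

/-! ### The LLL algorithm -/

section LLL

open InnerProductSpace Submodule

variable {κ : ℕ}

theorem det_lllBasis_ne_zero {B : Matrix (Fin κ) (Fin κ) ℝ} (hB : B.det ≠ 0)
    {U : Matrix (Fin κ) (Fin κ) ℤ} (hU : IsUnit U.det) : (lllBasis B U).det ≠ 0 := by
  have h1 : ((U.det : ℤ) : ℝ) = (U.map (fun a : ℤ => (a : ℝ))).det :=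
    RingHom.map_det (Int.castRingHom ℝ) U
  rw [lllBasis, Matrix.det_mul, ← h1]
  exact mul_ne_zero hB (by exact_mod_cast hU.ne_zero)

theorem linearIndependent_cols_lllBasis {B : Matrix (Fin κ) (Fin κ) ℝ} (hB : B.det ≠ 0)
    {U : Matrix (Fin κ) (Fin κ) ℤ} (hU : IsUnit U.det) :
    LinearIndependent ℝ (cols (lllBasis B U)) :=
  linearIndependent_cols_of_det_ne_zero (det_lllBasis_ne_zero hB hU)

theorem cols_reduceCol (B : Matrix (Fin κ) (Fin κ) ℝ) (k : Fin κ) (U : Matrix (Fin κ) (Fin κ) ℤ)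
    (j : Fin κ) : cols (lllBasis B (reduceCol B k U j)) =
      Function.update (cols (lllBasis B U)) k (cols (lllBasis B U) k -
        (round (gsCoeff (lllBasis B U) k j) : ℝ) • cols (lllBasis B U) j) := by
  funext a
  rcases eq_or_ne a k with rfl | ha
  · rw [Function.update_self]
    ext i
    simp only [cols, lllBasis, Matrix.mul_apply, Matrix.map_apply, reduceCol,
      Matrix.updateCol_self, PiLp.sub_apply, PiLp.smul_apply, smul_eq_mul, Finset.mul_sum,
      ← Finset.sum_sub_distrib]
    refine Finset.sum_congr rfl fun l _ => ?_
    push_cast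
    ring
  · rw [Function.update_of_ne ha]
    ext i
    simp only [cols, lllBasis, Matrix.mul_apply, Matrix.map_apply, reduceCol,
      Matrix.updateCol_ne ha]

theorem gs_reduceCol (B : Matrix (Fin κ) (Fin κ) ℝ) {j k : Fin κ} (hjk : j < k)
    (U : Matrix (Fin κ) (Fin κ) ℤ) (i : Fin κ) :
    gs (lllBasis B (reduceCol B k U j)) i = gs (lllBasis B U) i := by
  rw [gs, cols_reduceCol, gramSchmidt_update_sub_smul _ hjk]; rfl

theorem det_reduceCol (B : Matrix (Fin κ) (Fin κ) ℝ) {j k : Fin κ} (hjk : j < k)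
    (U : Matrix (Fin κ) (Fin κ) ℤ) : (reduceCol B k U j).det = U.det := by
  have h := Matrix.det_updateCol_add_smul_self U hjk.ne'
    (-(round (gsCoeff (lllBasis B U) k j)))
  rw [← h]
  congr 1
  ext a b
  simp [reduceCol, sub_eq_add_neg]

theorem gsCoeff_reduceCol_self (B : Matrix (Fin κ) (Fin κ) ℝ) (hB : B.det ≠ 0) {j k : Fin κ}
    (hjk : j < k) (U : Matrix (Fin κ) (Fin κ) ℤ) (hU : IsUnit U.det) :
    |gsCoeff (lllBasis B (reduceCol B k U j)) k j| ≤ 1 / 2 := by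
  have h0 := (norm_sq_gs_pos (linearIndependent_cols_lllBasis hB hU) j).ne'
  have : gsCoeff (lllBasis B (reduceCol B k U j)) k j =
      gsCoeff (lllBasis B U) k j - round (gsCoeff (lllBasis B U) k j) := by
    rw [gsCoeff, gs_reduceCol B hjk, cols_reduceCol, Function.update_self, inner_sub_right,
      inner_smul_right, sub_div]
    congr 1
    rw [gs, inner_gramSchmidt_self, mul_div_assoc, div_self, mul_one]
    exact h0
  rw [this]
  exact abs_sub_round _

theorem gsCoeff_reduceCol_of_lt (B : Matrix (Fin κ) (Fin κ) ℝ) {i j k : Fin κ} (hij : i < j)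
    (hjk : j < k) (U : Matrix (Fin κ) (Fin κ) ℤ) :
    gsCoeff (lllBasis B (reduceCol B k U i)) k j = gsCoeff (lllBasis B U) k j := by
  rw [gsCoeff, gs_reduceCol B (hij.trans hjk), cols_reduceCol, Function.update_self,
    inner_sub_right, inner_smul_right]
  rw [gs, gramSchmidt_inv_triangular ℝ _ hij, mul_zero, sub_zero]
  rfl

theorem foldl_reduceCol (B : Matrix (Fin κ) (Fin κ) ℝ) (k : Fin κ) (l : List (Fin κ))
    (hl : ∀ i ∈ l, i < k) (U : Matrix (Fin κ) (Fin κ) ℤ) :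
    (l.foldl (reduceCol B k) U).det = U.det ∧
      ∀ i, gs (lllBasis B (l.foldl (reduceCol B k) U)) i = gs (lllBasis B U) i := by
  induction l generalizing U with
  | nil => simp
  | cons a t ih =>
    obtain ⟨h1, h2⟩ := ih (fun i hi => hl i (List.mem_cons_of_mem _ hi)) (reduceCol B k U a)
    have ha := hl a List.mem_cons_self
    rw [List.foldl_cons]
    exact ⟨h1.trans (det_reduceCol B ha U), fun i => (h2 i).trans (gs_reduceCol B ha U i)⟩

theorem gsCoeff_foldl_reduceCol_of_lt (B : Matrix (Fin κ) (Fin κ) ℝ) {j k : Fin κ} (hjk : j < k)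
    (l : List (Fin κ)) (hl : ∀ i ∈ l, i < j) (U : Matrix (Fin κ) (Fin κ) ℤ) :
    gsCoeff (lllBasis B (l.foldl (reduceCol B k) U)) k j = gsCoeff (lllBasis B U) k j := by
  induction l generalizing U with
  | nil => simp
  | cons a t ih =>
    rw [List.foldl_cons, ih (fun i hi => hl i (List.mem_cons_of_mem _ hi)),
      gsCoeff_reduceCol_of_lt B (hl a List.mem_cons_self) hjk]

theorem abs_gsCoeff_foldl_reduceCol (B : Matrix (Fin κ) (Fin κ) ℝ) (hB : B.det ≠ 0)
    {j k : Fin κ} (l : List (Fin κ)) (hl : ∀ i ∈ l, i < k) (hp : l.Pairwise (fun a b => b < a))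
    (hj : j ∈ l) (U : Matrix (Fin κ) (Fin κ) ℤ) (hU : IsUnit U.det) :
    |gsCoeff (lllBasis B (l.foldl (reduceCol B k) U)) k j| ≤ 1 / 2 := by
  induction l generalizing U with
  | nil => simp at hj
  | cons a t ih =>
    have ha := hl a List.mem_cons_self
    rw [List.pairwise_cons] at hp
    rw [List.foldl_cons]
    rcases List.mem_cons.1 hj with rfl | hj
    · rw [gsCoeff_foldl_reduceCol_of_lt B ha t hp.1]
      exact gsCoeff_reduceCol_self B hB ha U hU
    · exact ih (fun i hi => hl i (List.mem_cons_of_mem _ hi)) hp.2 hj _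
        (by rwa [det_reduceCol B ha])

theorem det_sizeReduce (B : Matrix (Fin κ) (Fin κ) ℝ) (k : Fin κ) (U : Matrix (Fin κ) (Fin κ) ℤ) :
    (sizeReduce B k U).det = U.det :=
  (foldl_reduceCol B k _ (by simp) U).1

theorem gs_sizeReduce (B : Matrix (Fin κ) (Fin κ) ℝ) (k : Fin κ) (U : Matrix (Fin κ) (Fin κ) ℤ)
    (i : Fin κ) : gs (lllBasis B (sizeReduce B k U)) i = gs (lllBasis B U) i :=
  (foldl_reduceCol B k _ (by simp) U).2 i

theorem abs_gsCoeff_sizeReduce (B : Matrix (Fin κ) (Fin κ) ℝ) (hB : B.det ≠ 0) {j k : Fin κ}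
    (hjk : j < k) (U : Matrix (Fin κ) (Fin κ) ℤ) (hU : IsUnit U.det) :
    |gsCoeff (lllBasis B (sizeReduce B k U)) k j| ≤ 1 / 2 := by
  refine abs_gsCoeff_foldl_reduceCol B hB _ (by simp) ?_ (by simpa using hjk) U hU
  rw [List.pairwise_reverse]
  exact (List.pairwise_lt_finRange κ).filter _

theorem cols_swap (B : Matrix (Fin κ) (Fin κ) ℝ) (U : Matrix (Fin κ) (Fin κ) ℤ) (i j : Fin κ) :
    cols (lllBasis B (U.submatrix id (Equiv.swap i j))) =
      cols (lllBasis B U) ∘ Equiv.swap i j := by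
  funext a
  simp [cols, lllBasis, Matrix.mul_apply]

theorem isUnit_det_swap {U : Matrix (Fin κ) (Fin κ) ℤ} (hU : IsUnit U.det) (i j : Fin κ) :
    IsUnit (U.submatrix id (Equiv.swap i j)).det := by
  rw [Matrix.det_permute']
  exact (Units.isUnit _).map (Int.castRingHom ℤ) |>.mul hU

/-- A swap that follows a failed Lovász test decreases the potential by the factor `δ`. -/
theorem lllPotential_swap_le (B : Matrix (Fin κ) (Fin κ) ℝ) (hB : B.det ≠ 0)
    {U : Matrix (Fin κ) (Fin κ) ℤ} (hU : IsUnit U.det) {j k : Fin κ} (hjk : (j : ℕ) + 1 = k)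
    {δ : ℝ} (h : ‖gs (lllBasis B U) k‖ ^ 2 <
      (δ - gsCoeff (lllBasis B U) k j ^ 2) * ‖gs (lllBasis B U) j‖ ^ 2) :
    lllPotential (lllBasis B (U.submatrix id (Equiv.swap k j))) ≤
      δ * lllPotential (lllBasis B U) := by
  have hli := linearIndependent_cols_lllBasis hB hU
  have hne : k ≠ j := by rintro rfl; omega
  set A := lllBasis B U
  set A' := lllBasis B (U.submatrix id (Equiv.swap k j)) with hA'
  have hgs : ∀ i, gs A' i = gramSchmidt ℝ (cols A ∘ Equiv.swap k j) i := fun i => by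
    rw [gs, hA', cols_swap]
  have hsplit : ∀ F : Fin κ → ℝ,
      ∏ i, F i = F j * F k * ∏ i ∈ (Finset.univ.erase j).erase k, F i := fun F => by
    rw [← Finset.mul_prod_erase _ _ (Finset.mem_univ j), mul_assoc,
      ← Finset.mul_prod_erase (Finset.univ.erase j) F (a := k) (by simp [hne])]
  rw [lllPotential, lllPotential, hsplit, hsplit]
  have hrest : ∏ i ∈ (Finset.univ.erase j).erase k, (‖gs A' i‖ ^ 2) ^ (κ - (i : ℕ)) =
      ∏ i ∈ (Finset.univ.erase j).erase k, (‖gs A i‖ ^ 2) ^ (κ - (i : ℕ)) := by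
    refine Finset.prod_congr rfl fun i hi => ?_
    simp only [Finset.mem_erase, Finset.mem_univ, and_true] at hi
    rw [hgs, gramSchmidt_swap_of_ne _ hjk hi.2 hi.1]; rfl
  have hmul : ‖gs A' j‖ ^ 2 * ‖gs A' k‖ ^ 2 = ‖gs A j‖ ^ 2 * ‖gs A k‖ ^ 2 := by
    rw [hgs, hgs]; exact norm_sq_gramSchmidt_swap_mul _ hli hjk
  have hdec : ‖gs A' j‖ ^ 2 ≤ δ * ‖gs A j‖ ^ 2 := by
    have h1 : ‖gs A' j‖ ^ 2 =
        ‖gs A k‖ ^ 2 + gsCoeff A k j ^ 2 * ‖gs A j‖ ^ 2 := by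
      rw [hgs]; exact norm_sq_gramSchmidt_swap_left _ hjk
    rw [h1]; linarith
  have hexp : κ - (j : ℕ) = (κ - (k : ℕ)) + 1 := by have := k.2; omega
  rw [hrest, ← mul_assoc]
  refine mul_le_mul_of_nonneg_right ?_ (Finset.prod_nonneg fun _ _ => by positivity)
  rw [hexp]
  calc (‖gs A' j‖ ^ 2) ^ (κ - (k : ℕ) + 1) * (‖gs A' k‖ ^ 2) ^ (κ - (k : ℕ))
      = (‖gs A' j‖ ^ 2 * ‖gs A' k‖ ^ 2) ^ (κ - (k : ℕ)) * ‖gs A' j‖ ^ 2 := by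
        rw [mul_pow]; ring
    _ ≤ (‖gs A j‖ ^ 2 * ‖gs A k‖ ^ 2) ^ (κ - (k : ℕ)) * (δ * ‖gs A j‖ ^ 2) := by
        rw [hmul]; exact mul_le_mul_of_nonneg_left hdec (by positivity)
    _ = _ := by rw [mul_pow]; ring

/-- What is known about a state of the LLL algorithm, started on `B`, after `t` iterations of which
`p` were swaps: the transformation is unimodular, the columns before the working index satisfy the
weakened Lovász condition, the working index accounts for the iterations that were not swaps, and
each swap has decreased the potential by the factor `δ`. -/
structure LLLInvariant (δ : ℝ) (B : Matrix (Fin κ) (Fin κ) ℝ) (t p : ℕ) (st : LLLState κ) :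
    Prop where
  one_le : 1 ≤ st.k
  isUnit : IsUnit st.U.det
  lovasz : ∀ i j : Fin κ, (j : ℕ) + 1 = i → (i : ℕ) < st.k →
    (δ - 1 / 4) * ‖gs (lllBasis B st.U) j‖ ^ 2 ≤ ‖gs (lllBasis B st.U) i‖ ^ 2
  count : t + 1 ≤ 2 * p + st.k
  potential : lllPotential (lllBasis B st.U) ≤ δ ^ p * lllPotential B

theorem LLLInvariant.init (δ : ℝ) (B : Matrix (Fin κ) (Fin κ) ℝ) :
    LLLInvariant δ B 0 0 ⟨1, 1⟩ where
  one_le := le_rfl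
  isUnit := by simp
  lovasz i j hij hi := by simp only at hi; omega
  count := by simp
  potential := by simp [lllBasis]

theorem LLLInvariant.step {δ : ℝ} (hδ : 0 ≤ δ) {B : Matrix (Fin κ) (Fin κ) ℝ} (hB : B.det ≠ 0)
    {t p : ℕ} {st : LLLState κ} (h : LLLInvariant δ B t p st) (hk : st.k < κ) :
    ∃ p', LLLInvariant δ B (t + 1) p' (lllStep δ B st) := by
  have h1 := h.one_le
  let i : Fin κ := ⟨st.k, hk⟩
  let j : Fin κ := ⟨st.k - 1, lt_of_le_of_lt (Nat.sub_le _ _) hk⟩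
  have hji : (j : ℕ) + 1 = i := by simp only [i, j]; omega
  have hlt : j < i := by omega
  set V := sizeReduce B i st.U with hV
  have hVu : IsUnit V.det := by rw [hV, det_sizeReduce]; exact h.isUnit
  have hVgs : ∀ l, gs (lllBasis B V) l = gs (lllBasis B st.U) l := gs_sizeReduce B i st.U
  have hVpot : lllPotential (lllBasis B V) = lllPotential (lllBasis B st.U) := by
    simp only [lllPotential, hVgs]
  have hμ : gsCoeff (lllBasis B V) i j ^ 2 ≤ 1 / 4 := by
    have := abs_gsCoeff_sizeReduce B hB hlt st.U h.isUnit
    rw [← sq_abs]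
    calc _ ≤ (1 / 2 : ℝ) ^ 2 := pow_le_pow_left₀ (abs_nonneg _) this 2
      _ = 1 / 4 := by norm_num
  by_cases hL : (δ - gsCoeff (lllBasis B V) i j ^ 2) * ‖gs (lllBasis B V) j‖ ^ 2 ≤
      ‖gs (lllBasis B V) i‖ ^ 2
  · have hst : lllStep δ B st = ⟨V, st.k + 1⟩ := by
      rw [lllStep, dif_pos hk]; exact if_pos hL
    refine ⟨p, ?_⟩
    rw [hst]
    refine ⟨by simp, hVu, fun a b hab ha => ?_, by have := h.count; simp only; omega, ?_⟩
    · simp only at ha ⊢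
      rcases Nat.lt_succ_iff_lt_or_eq.1 ha with ha | ha
      · rw [hVgs, hVgs]; exact h.lovasz a b hab ha
      · have hai : a = i := Fin.ext ha
        have hbj : b = j := by apply Fin.ext; rw [hai] at hab; omega
        rw [hai, hbj]
        refine le_trans ?_ hL
        gcongr
    · rw [hVpot]; exact h.potential
  · have hst : lllStep δ B st = ⟨V.submatrix id (Equiv.swap i j), max (st.k - 1) 1⟩ := by
      rw [lllStep, dif_pos hk]; exact if_neg hL
    refine ⟨p + 1, ?_⟩
    rw [hst]
    refine ⟨by simp, isUnit_det_swap hVu i j, fun a b hab ha => ?_,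
      by have := h.count; simp only; omega, ?_⟩
    · simp only at ha ⊢
      have hgs : ∀ l, l < j → gs (lllBasis B (V.submatrix id (Equiv.swap i j))) l =
          gs (lllBasis B st.U) l := fun l hl => by
        rw [gs, cols_swap, gramSchmidt_swap_of_ne _ hji hl.ne (hl.trans hlt).ne]
        exact hVgs l
      have haj : (a : ℕ) < j := by simp only [j]; omega
      rw [hgs a haj, hgs b (by omega)]
      exact h.lovasz a b hab (by simp only [j] at haj; omega)
    · refine (lllPotential_swap_le B hB hVu hji (not_le.1 hL)).trans ?_
      rw [hVpot, pow_succ', mul_assoc]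
      exact mul_le_mul_of_nonneg_left h.potential hδ

theorem lllRun_succ (δ : ℝ) (B : Matrix (Fin κ) (Fin κ) ℝ) (t : ℕ) :
    lllRun δ B (t + 1) = lllStep δ B (lllRun δ B t) := by
  rw [lllRun, Function.iterate_succ_apply']; rfl

theorem exists_lllInvariant_lllRun {δ : ℝ} (hδ : 0 ≤ δ) {B : Matrix (Fin κ) (Fin κ) ℝ}
    (hB : B.det ≠ 0) (t : ℕ) (ht : ∀ s < t, (lllRun δ B s).k < κ) :
    ∃ p, LLLInvariant δ B t p (lllRun δ B t) := by
  induction t with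
  | zero => exact ⟨0, LLLInvariant.init δ B⟩
  | succ t ih =>
    obtain ⟨p, hp⟩ := ih fun s hs => ht s (by omega)
    rw [lllRun_succ]
    exact hp.step hδ hB (ht t (by omega))

/-- The LLL algorithm halts after a number of iterations that is logarithmic in the quotient of the
initial potential `≤ X ^ (κ * κ)` and its lower bound `c ^ (κ * κ)`; its output is unimodular and
satisfies the weakened Lovász condition throughout. -/
theorem lll_spec {δ : ℝ} (hδ : 0 ≤ δ) (hδ1 : δ ≤ 1) {B : Matrix (Fin κ) (Fin κ) ℝ}
    (hB : B.det ≠ 0) {c X : ℝ} (hc : 0 ≤ c) (hc1 : c ≤ 1)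
    (hBc : ∀ x, c * sqNorm x ≤ sqNorm (B *ᵥ x)) (hX : 1 ≤ X) (hBX : ∀ j, ‖gs B j‖ ^ 2 ≤ X)
    {P : ℕ} (hP : δ ^ P * X ^ (κ * κ) < c ^ (κ * κ)) :
    lllIterations δ B ≤ (2 * P + κ : ℕ) ∧ IsUnit (lllOutput δ B).det ∧
      ∀ i j : Fin κ, (j : ℕ) + 1 = i →
        (δ - 1 / 4) * ‖gs (lllBasis B (lllOutput δ B)) j‖ ^ 2 ≤
          ‖gs (lllBasis B (lllOutput δ B)) i‖ ^ 2 := by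
  have hbound : ∀ t p st, LLLInvariant δ B t p st → p < P := by
    intro t p st h
    by_contra hp
    have h1 := lllPotential_ge B st.U h.isUnit hc hc1 hBc
    have h2 : δ ^ p * lllPotential B ≤ δ ^ P * X ^ (κ * κ) :=
      mul_le_mul (pow_le_pow_of_le_one hδ hδ1 (not_lt.1 hp)) (lllPotential_le B hX hBX)
        (lllPotential_nonneg B) (by positivity)
    exact absurd (h1.trans (h.potential.trans h2)) (not_le.2 hP)
  have hex : ∃ t, κ ≤ (lllRun δ B t).k := by
    by_contra! hno
    obtain ⟨p, hp⟩ := exists_lllInvariant_lllRun hδ hB (2 * P + κ) fun s _ => hno s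
    have h1 := hbound _ _ _ hp
    have h2 := hp.count
    have h3 := hno (2 * P + κ)
    omega
  classical
  obtain ⟨p, hp⟩ := exists_lllInvariant_lllRun hδ hB (Nat.find hex)
    fun s hs => not_le.1 (Nat.find_min hex hs)
  have hit : lllIterations δ B = (Nat.find hex : ℕ) := by
    refine le_antisymm (iInf₂_le (f := fun (t : ℕ)
      (_ : t ∈ {t : ℕ | κ ≤ (lllRun δ B t).k}) => (t : ℕ∞)) (Nat.find hex) (Nat.find_spec hex)) (le_iInf₂ fun t ht => ?_)
    exact_mod_cast Nat.find_min' hex ht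
  have hle : Nat.find hex ≤ 2 * P + κ := by
    by_contra hgt
    obtain ⟨p, hp⟩ := exists_lllInvariant_lllRun hδ hB (2 * P + κ)
      fun s hs => not_le.1 (Nat.find_min hex (by omega))
    have h1 := hbound _ _ _ hp
    have h2 := hp.count
    have h3 := not_le.1 (Nat.find_min hex (m := 2 * P + κ) (by omega))
    omega
  have hout : lllOutput δ B = (lllRun δ B (Nat.find hex)).U := by
    rw [lllOutput, hit]; rfl
  refine ⟨by rw [hit]; exact_mod_cast hle, by rw [hout]; exact hp.isUnit, fun i j hij => ?_⟩
  rw [hout]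
  exact hp.lovasz i j hij (lt_of_lt_of_le i.2 (Nat.find_spec hex))

/-- In an LLL-reduced basis no Gram-Schmidt vector is much shorter than the first basis vector. -/
theorem norm_sq_gs_ge_of_lovasz {β : ℝ} (hβ : 0 ≤ β) (hβ1 : β ≤ 1)
    {A : Matrix (Fin κ) (Fin κ) ℝ}
    (h : ∀ i j : Fin κ, (j : ℕ) + 1 = i → β * ‖gs A j‖ ^ 2 ≤ ‖gs A i‖ ^ 2)
    (i₀ : Fin κ) (h0 : (i₀ : ℕ) = 0) (i : Fin κ) :
    β ^ κ * ‖cols A i₀‖ ^ 2 ≤ ‖gs A i‖ ^ 2 := by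
  have h1 : gs A i₀ = cols A i₀ := by
    refine gramSchmidt_eq_of_orthogonal _ _ _ (by simp) fun j hj => ?_
    have : (j : ℕ) < i₀ := hj
    omega
  have h2 : ∀ n (hn : n < κ), β ^ n * ‖cols A i₀‖ ^ 2 ≤ ‖gs A ⟨n, hn⟩‖ ^ 2 := by
    intro n
    induction n with
    | zero =>
      intro hn
      have : (⟨0, hn⟩ : Fin κ) = i₀ := Fin.ext h0.symm
      rw [this, h1]; simp
    | succ n ih =>
      intro hn
      refine le_trans ?_ (h ⟨n + 1, hn⟩ ⟨n, by omega⟩ rfl)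
      rw [pow_succ', mul_assoc]
      exact mul_le_mul_of_nonneg_left (ih _) hβ
  refine le_trans ?_ (h2 i i.2)
  exact mul_le_mul_of_nonneg_right (pow_le_pow_of_le_one hβ hβ1 i.2.le) (by positivity)

end LLL

/-! ### Lattice points in a sphere -/

section Sphere

theorem encard_le_of_last_difference_le {ι : Type*} [Fintype ι] [LinearOrder ι]
    (S : Set (ι → ℤ)) (N : ℕ)
    (h : ∀ s ∈ S, ∀ s' ∈ S, ∀ j, (∀ i, j < i → s i = s' i) → |s j - s' j| ≤ N) :
    S.encard ≤ ((N + 1) ^ Fintype.card ι : ℕ) := by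
  -- Reduction modulo `N + 1` is injective on `S`: look at the last index where two points differ.
  let φ : (ι → ℤ) → (ι → ZMod (N + 1)) := fun s i => (s i : ZMod (N + 1))
  have hinj : Set.InjOn φ S := by
    intro s hs s' hs' heq
    by_contra hne
    obtain ⟨i, hi⟩ := Function.ne_iff.1 hne
    have hT : (Finset.univ.filter fun i => s i ≠ s' i).Nonempty := ⟨i, by simpa using hi⟩
    obtain ⟨j, hj, hmax⟩ := Finset.exists_max_image _ id hT
    have hj' : s j ≠ s' j := by simpa using hj
    have h1 := h s hs s' hs' j fun i hi => by
      by_contra hc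
      exact absurd (hmax i (by simpa using hc)) (not_le.2 hi)
    have h2 : ((N + 1 : ℕ) : ℤ) ∣ s j - s' j := by
      rw [← ZMod.intCast_zmod_eq_zero_iff_dvd, Int.cast_sub, sub_eq_zero]
      exact congrFun heq j
    have h3 := Int.le_of_dvd (abs_pos.2 (sub_ne_zero.2 hj')) ((dvd_abs _ _).2 h2)
    push_cast at h3
    omega
  calc S.encard ≤ (Set.univ : Set (ι → ZMod (N + 1))).encard :=
        Set.encard_le_encard_of_injOn (Set.mapsTo_univ _ _) hinj
    _ = _ := by
        rw [Set.encard_univ, ENat.card_eq_coe_fintype_card, Fintype.card_fun, ZMod.card]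

theorem encard_sphere_le {ι : Type*} [Fintype ι] [LinearOrder ι] (v : ι → ℝ) (C : Matrix ι ι ℝ)
    (hC : ∀ i j, j < i → C i j = 0) {d ξ : ℝ} (hξ : 0 ≤ ξ) (hd : 0 < d)
    (hCd : ∀ j, d ≤ |C j j|) {N : ℕ} (hN : 2 * ξ < d * (N + 1)) :
    {s : ι → ℤ | sqNorm (v - C *ᵥ intVec s) ≤ ξ ^ 2}.encard ≤
      ((N + 1) ^ Fintype.card ι : ℕ) := by
  refine encard_le_of_last_difference_le _ N fun s hs s' hs' j hj => ?_
  have h1 : ∀ t : ι → ℤ, sqNorm (v - C *ᵥ intVec t) ≤ ξ ^ 2 →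
      |(v - C *ᵥ intVec t) j| ≤ ξ := fun t ht =>
    abs_le_of_sq_le_sq ((sq_le_sqNorm _ j).trans ht) hξ
  have h2 : (v - C *ᵥ intVec s') j - (v - C *ᵥ intVec s) j = C j j * ((s j - s' j : ℤ) : ℝ) := by
    have : (v - C *ᵥ intVec s') j - (v - C *ᵥ intVec s) j =
        ∑ i, C j i * ((s i : ℝ) - s' i) := by
      simp only [Pi.sub_apply, Matrix.mulVec, dotProduct, intVec, mul_sub, Finset.sum_sub_distrib]
      ring
    rw [this, Finset.sum_eq_single j]
    · push_cast; ring
    · intro i _ hij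
      rcases lt_or_gt_of_ne hij with hlt | hgt
      · rw [hC j i hlt, zero_mul]
      · rw [hj i hgt, sub_self, mul_zero]
    · simp
  have h3 : |C j j| * |((s j - s' j : ℤ) : ℝ)| ≤ 2 * ξ := by
    rw [← abs_mul, ← h2]
    have := abs_sub ((v - C *ᵥ intVec s') j) ((v - C *ᵥ intVec s) j)
    have ha := h1 s hs
    have hb := h1 s' hs'
    linarith
  have h4 : d * |((s j - s' j : ℤ) : ℝ)| < d * (N + 1) :=
    lt_of_le_of_lt (mul_le_mul_of_nonneg_right (hCd j) (abs_nonneg _)) (lt_of_le_of_lt h3 hN)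
  have h5 := lt_of_mul_lt_mul_left h4 hd.le
  rw [← Int.cast_abs] at h5
  have h6 : |s j - s' j| < (N : ℤ) + 1 := by exact_mod_cast h5
  omega

variable {κ : ℕ}

theorem visitedCount_le (v : Fin κ → ℝ) (A : Matrix (Fin κ) (Fin κ) ℝ)
    (hA : ∀ i j, j < i → A i j = 0) {d ξ : ℝ} (hξ : 0 ≤ ξ) (hd : 0 < d)
    (hAd : ∀ j, d ≤ |A j j|) {N : ℕ} (hN : 2 * ξ < d * (N + 1)) :
    visitedCount ξ v A ≤ (κ * (N + 1) ^ κ : ℕ) := by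
  have h : ∀ k ∈ Finset.Icc 1 κ, (visited ξ v A k).encard ≤ ((N + 1) ^ κ : ℕ) := by
    intro k _
    have h1 := encard_sphere_le (fun i : LastIdx κ k => v i)
      (A.submatrix (Subtype.val : LastIdx κ k → Fin κ) Subtype.val)
      (fun i j hij => hA _ _ hij) hξ hd (fun j => hAd _) hN
    refine h1.trans ?_
    have h2 : Fintype.card (LastIdx κ k) ≤ κ := by
      simpa using Fintype.card_subtype_le (fun i : Fin κ => κ ≤ (i : ℕ) + k)
    exact_mod_cast Nat.pow_le_pow_right (Nat.succ_pos N) h2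
  refine (Finset.sum_le_card_nsmul _ _ _ h).trans ?_
  simp

theorem metric_add (v : Fin κ → ℝ) (A : Matrix (Fin κ) (Fin κ) ℝ) (s t : Fin κ → ℤ) :
    metric v A (s + t) = metric v A s + sqNorm (A *ᵥ intVec t) -
      2 * ((A *ᵥ intVec t) ⬝ᵥ (v - A *ᵥ intVec s)) := by
  have h : v - A *ᵥ intVec (s + t) = (v - A *ᵥ intVec s) - A *ᵥ intVec t := by
    have : (intVec (s + t) : Fin κ → ℝ) = intVec s + intVec t := by
      funext i; simp [intVec]
    rw [this, Matrix.mulVec_add, sub_sub]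
  rw [metric, metric, h]
  generalize v - A *ᵥ intVec s = x
  rw [sqNorm_eq_dotProduct, sqNorm_eq_dotProduct, sqNorm_eq_dotProduct,
    sub_dotProduct, dotProduct_sub, dotProduct_sub, dotProduct_comm x (A *ᵥ intVec t)]
  ring

theorem argminOn_univ_nonempty (v : Fin κ → ℝ) (A : Matrix (Fin κ) (Fin κ) ℝ)
    (hA : ∀ i j, j < i → A i j = 0) (hAd : ∀ j, A j j ≠ 0) :
    (argminOn v A Set.univ).Nonempty := by
  obtain ⟨d, hd, hdA⟩ : ∃ d > 0, ∀ j, d ≤ |A j j| := by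
    rcases isEmpty_or_nonempty (Fin κ) with he | he
    · exact ⟨1, one_pos, fun j => he.elim j⟩
    · obtain ⟨j, hj⟩ := Finite.exists_min fun j => |A j j|
      exact ⟨_, abs_pos.2 (hAd j), hj⟩
  set ξ := √(metric v A 0)
  have hξ : ξ ^ 2 = metric v A 0 := Real.sq_sqrt (sqNorm_nonneg _)
  have hN : 2 * ξ < d * ((⌊2 * ξ / d⌋₊ : ℕ) + 1) := by
    have := Nat.lt_floor_add_one (2 * ξ / d)
    rwa [div_lt_iff₀' hd] at this
  have hfin : {s : Fin κ → ℤ | sqNorm (v - A *ᵥ intVec s) ≤ ξ ^ 2}.Finite := by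
    rw [← Set.encard_lt_top_iff]
    exact (encard_sphere_le v A hA (Real.sqrt_nonneg _) hd hdA hN).trans_lt (ENat.natCast_lt_top _)
  obtain ⟨s, hs, hmin⟩ := Set.exists_min_image _ (metric v A) hfin ⟨0, hξ.ge⟩
  refine ⟨s, Set.mem_univ _, fun s' _ => ?_⟩
  by_cases h : metric v A s' ≤ ξ ^ 2
  · exact hmin s' h
  · exact hs.out.trans (not_le.1 h).le

theorem intVec_mulVec (U : Matrix (Fin κ) (Fin κ) ℤ) (s : Fin κ → ℤ) :
    intVec (U *ᵥ s) = U.map (fun a : ℤ => (a : ℝ)) *ᵥ intVec s := by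
  funext i
  simp [intVec, Matrix.mulVec, dotProduct]

theorem metric_qr (v : Fin κ → ℝ) {B : Matrix (Fin κ) (Fin κ) ℝ} (hB : B.det ≠ 0)
    {U : Matrix (Fin κ) (Fin κ) ℤ} (hU : IsUnit U.det) (s : Fin κ → ℤ) :
    metric ((qrQ (lllBasis B U))ᵀ *ᵥ v) (qrR (lllBasis B U)) s = metric v B (U *ᵥ s) := by
  have hQ := qrQ_transpose_mul_self (linearIndependent_cols_lllBasis hB hU)
  have hQ' : ((qrQ (lllBasis B U))ᵀ)ᵀ * (qrQ (lllBasis B U))ᵀ = 1 := by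
    rw [Matrix.transpose_transpose]; exact mul_eq_one_comm.1 hQ
  have h : (qrQ (lllBasis B U))ᵀ *ᵥ v - qrR (lllBasis B U) *ᵥ intVec s =
      (qrQ (lllBasis B U))ᵀ *ᵥ (v - B *ᵥ intVec (U *ᵥ s)) := by
    rw [qrR, intVec_mulVec, Matrix.mulVec_sub, Matrix.mulVec_mulVec, Matrix.mulVec_mulVec,
      lllBasis, Matrix.mul_assoc]
  rw [metric, h, sqNorm_mulVec_of_orthogonal hQ', metric]

/-- The sphere decoder for the reduced basis finds exactly the minimisers over the whole lattice,
as soon as some lattice point lies in the sphere. -/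
theorem image_argminOn_inSphere (v : Fin κ → ℝ) {B : Matrix (Fin κ) (Fin κ) ℝ} (hB : B.det ≠ 0)
    {U : Matrix (Fin κ) (Fin κ) ℤ} (hU : IsUnit U.det) {ξ : ℝ} {s₀ : Fin κ → ℤ}
    (hs₀ : metric v B s₀ ≤ ξ ^ 2) :
    (fun s => U *ᵥ s) '' argminOn ((qrQ (lllBasis B U))ᵀ *ᵥ v) (qrR (lllBasis B U))
      (inSphere ξ ((qrQ (lllBasis B U))ᵀ *ᵥ v) (qrR (lllBasis B U))) =
    argminOn v B Set.univ := by
  have hinv : ∀ s : Fin κ → ℤ, U *ᵥ (U⁻¹ *ᵥ s) = s := fun s => by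
    rw [Matrix.mulVec_mulVec, Matrix.mul_nonsing_inv _ hU, Matrix.one_mulVec]
  ext s
  simp only [argminOn, inSphere, metric_qr v hB hU, Set.mem_image, Set.mem_ofPred_eq,
    Set.mem_univ, true_and, forall_true_left]
  constructor
  · rintro ⟨t, ⟨ht, hmin⟩, rfl⟩ s'
    by_cases h : metric v B s' ≤ ξ ^ 2
    · have := hmin (U⁻¹ *ᵥ s') (by rwa [hinv])
      rwa [hinv] at this
    · exact ht.trans (not_le.1 h).le
  · intro h
    refine ⟨U⁻¹ *ᵥ s, ⟨?_, fun t _ => ?_⟩, hinv s⟩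
    · rw [hinv]; exact (h s₀).trans hs₀
    · rw [hinv]; exact h _

theorem inSphere_nonempty (v : Fin κ → ℝ) {B : Matrix (Fin κ) (Fin κ) ℝ} (hB : B.det ≠ 0)
    {U : Matrix (Fin κ) (Fin κ) ℤ} (hU : IsUnit U.det) {ξ : ℝ} {s₀ : Fin κ → ℤ}
    (hs₀ : metric v B s₀ ≤ ξ ^ 2) :
    (inSphere ξ ((qrQ (lllBasis B U))ᵀ *ᵥ v) (qrR (lllBasis B U))).Nonempty := by
  refine ⟨U⁻¹ *ᵥ s₀, ?_⟩
  rw [inSphere, Set.mem_ofPred_eq, metric_qr v hB hU, Matrix.mulVec_mulVec,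
    Matrix.mul_nonsing_inv _ hU, Matrix.one_mulVec]
  exact hs₀

end Sphere

/-! ### The preprocessed channel -/

namespace LatticeLink

variable {m n κ : ℕ} (L : LatticeLink m n κ)

theorem alpha_pos (r : ℝ) {ρ : ℝ} (hρ : 0 < ρ) : 0 < L.alpha r ρ := Real.rpow_pos_of_pos hρ _

/-- The code-channel matrix stacked on top of `α I`, whose triangular factor is the feedback
filter. -/
noncomputable def stacked (r ρ : ℝ) (H : Matrix (Fin n) (Fin m) ℝ) :
    Matrix (Fin n ⊕ Fin κ) (Fin κ) ℝ :=
  Matrix.fromRows (L.codeChannel r ρ H) (L.alpha r ρ • (1 : Matrix (Fin κ) (Fin κ) ℝ))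

variable (r : ℝ) {ρ : ℝ} (H : Matrix (Fin n) (Fin m) ℝ)

theorem linearIndependent_cols_stacked (hρ : 0 < ρ) :
    LinearIndependent ℝ (cols (L.stacked r ρ H)) := by
  refine linearIndependent_cols fun x hx => ?_
  have h := congrArg (fun v => v ∘ Sum.inr) hx
  rw [stacked, Matrix.fromRows_mulVec] at h
  simp only [Sum.elim_comp_inr, Matrix.smul_mulVec, Matrix.one_mulVec] at h
  exact (smul_eq_zero.1 (h.trans rfl)).resolve_left (L.alpha_pos r hρ).ne'

theorem stacked_transpose_mul_self : (L.stacked r ρ H)ᵀ * L.stacked r ρ H =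
    (L.codeChannel r ρ H)ᵀ * L.codeChannel r ρ H +
      L.alpha r ρ ^ 2 • (1 : Matrix (Fin κ) (Fin κ) ℝ) := by
  rw [stacked, Matrix.transpose_fromRows, Matrix.fromCols_mul_fromRows]
  simp [smul_smul, sq]

theorem feedback_transpose_mul_self (hρ : 0 < ρ) : (L.feedback r ρ H)ᵀ * L.feedback r ρ H =
    (L.codeChannel r ρ H)ᵀ * L.codeChannel r ρ H +
      L.alpha r ρ ^ 2 • (1 : Matrix (Fin κ) (Fin κ) ℝ) := by
  rw [← L.stacked_transpose_mul_self]
  exact qrR_transpose_mul_self (L.linearIndependent_cols_stacked r H hρ)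

theorem det_feedback_ne_zero (hρ : 0 < ρ) : (L.feedback r ρ H).det ≠ 0 :=
  det_qrR_ne_zero (L.linearIndependent_cols_stacked r H hρ)

theorem sqNorm_feedback_mulVec (hρ : 0 < ρ) (x : Fin κ → ℝ) :
    sqNorm (L.feedback r ρ H *ᵥ x) =
      sqNorm (L.codeChannel r ρ H *ᵥ x) + L.alpha r ρ ^ 2 * sqNorm x := by
  have h : ∀ {ι : Type} [Fintype ι] (A : Matrix ι (Fin κ) ℝ),
      sqNorm (A *ᵥ x) = x ⬝ᵥ ((Aᵀ * A) *ᵥ x) := fun A => by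
    rw [sqNorm_eq_dotProduct, Matrix.dotProduct_mulVec, ← Matrix.mulVec_transpose,
      Matrix.mulVec_mulVec, dotProduct_comm]
  rw [h, h, L.feedback_transpose_mul_self r H hρ, Matrix.add_mulVec, dotProduct_add,
    Matrix.smul_mulVec, Matrix.one_mulVec, dotProduct_smul, sqNorm_eq_dotProduct, smul_eq_mul]

theorem received_eq (hρ : 0 < ρ) (s : Fin κ → ℤ) (w : Fin n → ℝ) :
    L.received r ρ s H w = L.codeChannel r ρ H *ᵥ intVec s + w := by
  rw [received, codeword, codeChannel, Matrix.mulVec_smul, Matrix.smul_mulVec, smul_smul,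
    Matrix.mulVec_mulVec, Real.sqrt_eq_rpow, ← Real.rpow_add hρ, ← sub_eq_add_neg]

/-- The residual at the transmitted point, seen through `Rᵀ`: filtered noise plus the bias due to
the regularisation. -/
theorem feedback_transpose_mulVec_residual (hρ : 0 < ρ) (s : Fin κ → ℤ) (w : Fin n → ℝ) :
    (L.feedback r ρ H)ᵀ *ᵥ (L.forward r ρ H *ᵥ L.received r ρ s H w -
        L.feedback r ρ H *ᵥ intVec s) =
      (L.codeChannel r ρ H)ᵀ *ᵥ w - L.alpha r ρ ^ 2 • intVec s := by
  have hdet : IsUnit ((L.feedback r ρ H)ᵀ).det := by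
    rw [Matrix.det_transpose]; exact (L.det_feedback_ne_zero r H hρ).isUnit
  rw [Matrix.mulVec_sub, Matrix.mulVec_mulVec, Matrix.mulVec_mulVec, forward, ← Matrix.mul_assoc,
    Matrix.mul_nonsing_inv _ hdet, Matrix.one_mul, L.feedback_transpose_mul_self r H hρ,
    L.received_eq r H hρ, Matrix.mulVec_add, Matrix.add_mulVec, Matrix.mulVec_mulVec,
    Matrix.smul_mulVec, Matrix.one_mulVec]
  abel

theorem residual_eq (hρ : 0 < ρ) (s : Fin κ → ℤ) (w : Fin n → ℝ) :
    L.forward r ρ H *ᵥ L.received r ρ s H w - L.feedback r ρ H *ᵥ intVec s =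
      (qrQ (L.stacked r ρ H))ᵀ *ᵥ Sum.elim w (-L.alpha r ρ • intVec s) := by
  have hdet : ((L.feedback r ρ H)ᵀ).det ≠ 0 := by
    rw [Matrix.det_transpose]; exact L.det_feedback_ne_zero r H hρ
  rw [← sub_eq_zero]
  refine Matrix.eq_zero_of_mulVec_eq_zero hdet ?_
  have h2 : (L.feedback r ρ H)ᵀ * (qrQ (L.stacked r ρ H))ᵀ = (L.stacked r ρ H)ᵀ := by
    rw [← Matrix.transpose_mul]
    congr 1
    exact qrQ_mul_qrR (L.linearIndependent_cols_stacked r H hρ)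
  rw [Matrix.mulVec_sub, L.feedback_transpose_mulVec_residual r H hρ, Matrix.mulVec_mulVec, h2,
    stacked, Matrix.transpose_fromRows, Matrix.fromCols_mulVec_sumElim, Matrix.transpose_smul,
    Matrix.transpose_one, Matrix.smul_mulVec, Matrix.one_mulVec, smul_smul]
  rw [sub_eq_zero, sub_eq_add_neg, ← neg_smul]
  congr 2
  ring

theorem metric_received_le (hρ : 0 < ρ) (s : Fin κ → ℤ) (w : Fin n → ℝ) :
    metric (L.forward r ρ H *ᵥ L.received r ρ s H w) (L.feedback r ρ H) s ≤
      sqNorm w + L.alpha r ρ ^ 2 * sqNorm (intVec s) := by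
  rw [metric, L.residual_eq r H hρ]
  refine (sqNorm_transpose_mulVec_le
    (qrQ_transpose_mul_self (L.linearIndependent_cols_stacked r H hρ)) _).trans_eq ?_
  rw [sqNorm, Fintype.sum_sum_type]
  simp [sqNorm, mul_pow, Finset.mul_sum]

theorem metric_received_add (hρ : 0 < ρ) (s v : Fin κ → ℤ) (w : Fin n → ℝ) :
    metric (L.forward r ρ H *ᵥ L.received r ρ s H w) (L.feedback r ρ H) (s + v) =
      metric (L.forward r ρ H *ᵥ L.received r ρ s H w) (L.feedback r ρ H) s +
        (sqNorm (L.codeChannel r ρ H *ᵥ intVec v) + L.alpha r ρ ^ 2 * sqNorm (intVec v)) -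
        2 * (w ⬝ᵥ (L.codeChannel r ρ H *ᵥ intVec v) -
          L.alpha r ρ ^ 2 * (intVec s ⬝ᵥ intVec v)) := by
  rw [metric_add, L.sqNorm_feedback_mulVec r H hρ]
  congr 2
  rw [dotProduct_comm, Matrix.dotProduct_mulVec, ← Matrix.mulVec_transpose,
    L.feedback_transpose_mulVec_residual r H hρ, sub_dotProduct, smul_dotProduct,
    Matrix.mulVec_transpose, ← Matrix.dotProduct_mulVec, smul_eq_mul]

/-- The exact decoder errs if some other lattice point beats the transmitted one. -/
theorem exactDecoder_ne (hρ : 0 < ρ) {tie : Set (Fin κ → ℤ) → (Fin κ → ℤ)}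
    (htie : ∀ A, A.Nonempty → tie A ∈ A) {s v : Fin κ → ℤ} {w : Fin n → ℝ}
    (h : sqNorm (L.codeChannel r ρ H *ᵥ intVec v) + L.alpha r ρ ^ 2 * sqNorm (intVec v) <
      2 * (w ⬝ᵥ (L.codeChannel r ρ H *ᵥ intVec v) -
          L.alpha r ρ ^ 2 * (intVec s ⬝ᵥ intVec v))) :
    L.exactDecoder tie r ρ H (L.received r ρ s H w) ≠ s := by
  intro heq
  have hli := L.linearIndependent_cols_stacked r H hρ
  have hne := argminOn_univ_nonempty (L.forward r ρ H *ᵥ L.received r ρ s H w)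
    (L.feedback r ρ H) (fun i j hij => qrR_apply_of_lt _ hij)
    (fun j => by
      have := qrR_apply_self hli j
      exact this.trans_ne (norm_ne_zero_iff.2 (gs_ne_zero hli j)))
  have hmem := htie _ hne
  rw [exactDecoder] at heq
  rw [heq] at hmem
  have h1 := hmem.2 (s + v) (Set.mem_univ _)
  rw [L.metric_received_add r H hρ] at h1
  linarith

/-- Unless it is interrupted, or the transmitted point lies outside the sphere, the LR-aided
decoder agrees with the exact one. -/
theorem lrDecoder_eq (hρ : 0 < ρ) {c : FlopCosts} {tie : Set (Fin κ → ℤ) → (Fin κ → ℤ)}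
    {δ ξ N : ℝ} {y : Fin n → ℝ} (hU : IsUnit (L.lrTransform δ r ρ H).det)
    (hN : (L.flops c δ ξ r ρ H y : ℝ≥0∞) < ENNReal.ofReal N) {s : Fin κ → ℤ}
    (hs : metric (L.forward r ρ H *ᵥ y) (L.feedback r ρ H) s ≤ ξ ^ 2) :
    L.lrDecoder c tie δ ξ N r ρ H y = some (L.exactDecoder tie r ρ H y) := by
  have hdet := L.det_feedback_ne_zero r H hρ
  rw [lrDecoder, if_neg (not_le.2 hN), if_neg]
  · rw [exactDecoder]
    congr 2
    exact image_argminOn_inSphere _ hdet hU hs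
  · exact (inSphere_nonempty _ hdet hU hs).ne_empty

theorem norm_sq_gs_feedback_le (hρ : 0 < ρ) (j : Fin κ) :
    ‖gs (L.feedback r ρ H) j‖ ^ 2 ≤
      sqNorm (L.codeChannel r ρ H *ᵥ Pi.single j 1) + L.alpha r ρ ^ 2 := by
  refine (norm_sq_gs_le _ j).trans_eq ?_
  rw [L.sqNorm_feedback_mulVec r H hρ]
  congr 1
  simp [sqNorm, Pi.single_apply]

/-- Complexity of the LR-aided decoder when the lattice has no vectors shorter than `√ℓ`: the
potential argument limits the LLL iterations through `P`, and the Lovász condition gives the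
triangular factor a diagonal of at least `√((δ - 1/4) ^ κ * ℓ)`, which limits the visited nodes
through `N`. -/
theorem flops_le (hρ : 0 < ρ) (hκ : 0 < κ) {δ : ℝ} (hδ : 1 / 4 < δ) (hδ1 : δ < 1)
    (hα : L.alpha r ρ ≤ 1) {X : ℝ} (hX : 1 ≤ X)
    (hX' : ∀ j, sqNorm (L.codeChannel r ρ H *ᵥ Pi.single j 1) + L.alpha r ρ ^ 2 ≤ X)
    {P : ℕ} (hP : δ ^ P * X ^ (κ * κ) < (L.alpha r ρ ^ 2) ^ (κ * κ))
    {ℓ : ℝ} (hℓ : 0 < ℓ)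
    (hmin : ∀ v : Fin κ → ℤ, v ≠ 0 → ℓ < sqNorm (L.codeChannel r ρ H *ᵥ intVec v) +
      L.alpha r ρ ^ 2 * sqNorm (intVec v))
    {ξ : ℝ} (hξ : 0 ≤ ξ) {N : ℕ} (hN : 2 * ξ < √((δ - 1 / 4) ^ κ * ℓ) * (N + 1))
    (c : FlopCosts) (y : Fin n → ℝ) :
    IsUnit (L.lrTransform δ r ρ H).det ∧ L.flops c δ ξ r ρ H y ≤
      (c.once + c.perLLLIteration * (2 * P + κ) + c.perNode * (κ * (N + 1) ^ κ) : ℕ) := by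
  have hdet := L.det_feedback_ne_zero r H hρ
  obtain ⟨hit, hU, hlov⟩ := lll_spec (by linarith) hδ1.le hdet (sq_nonneg (L.alpha r ρ))
    (pow_le_one₀ (L.alpha_pos r hρ).le hα)
    (fun x => by
      rw [L.sqNorm_feedback_mulVec r H hρ]
      linarith [sqNorm_nonneg (L.codeChannel r ρ H *ᵥ x)]) hX
    (fun j => (L.norm_sq_gs_feedback_le r H hρ j).trans (hX' j)) hP
  refine ⟨hU, ?_⟩
  have hli := linearIndependent_cols_lllBasis hdet hU
  have hdiag : ∀ j, √((δ - 1 / 4) ^ κ * ℓ) ≤ |L.lrR δ r ρ H j j| := by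
    intro j
    have h1 : L.lrR δ r ρ H j j = ‖gs (L.lrBasis δ r ρ H) j‖ := qrR_apply_self hli j
    rw [h1, abs_norm, Real.sqrt_le_left (norm_nonneg _)]
    have h2 := norm_sq_gs_ge_of_lovasz (by linarith) (by linarith) hlov ⟨0, hκ⟩ rfl j
    refine le_trans (mul_le_mul_of_nonneg_left ?_ (pow_nonneg (by linarith) _)) h2
    let v : Fin κ → ℤ := L.lrTransform δ r ρ H *ᵥ Pi.single ⟨0, hκ⟩ 1
    have hv : v ≠ 0 := fun h0 => by
      have := Matrix.eq_zero_of_mulVec_eq_zero hU.ne_zero h0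
      simpa using congrFun this ⟨0, hκ⟩
    have hcol : ‖cols (lllBasis (L.feedback r ρ H) (lllOutput δ (L.feedback r ρ H)))
        ⟨0, hκ⟩‖ ^ 2 = sqNorm (L.feedback r ρ H *ᵥ intVec v) := by
      rw [cols, norm_toLp_sq, intVec_mulVec, Matrix.mulVec_mulVec]
      have : (intVec (Pi.single (⟨0, hκ⟩ : Fin κ) (1 : ℤ)) : Fin κ → ℝ) =
          Pi.single ⟨0, hκ⟩ 1 := by
        funext i; simp [intVec, Pi.single_apply]
      rw [this, Matrix.mulVec_single_one]; rfl
    rw [hcol, L.sqNorm_feedback_mulVec r H hρ]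
    exact (hmin v hv).le
  have hvis := visitedCount_le (L.lrObs δ r ρ H y) (L.lrR δ r ρ H)
    (fun i j hij => qrR_apply_of_lt _ hij) hξ
    (Real.sqrt_pos.2 (mul_pos (pow_pos (by linarith) _) hℓ)) hdiag hN
  rw [flops]
  push_cast at hit hvis ⊢
  gcongr

end LatticeLink

/-! ### Standard Gaussian noise -/

section Gaussian

variable {n : ℕ}

theorem gaussianReal_pos_of_volume_pos {s : Set ℝ} (hs : volume s ≠ 0) :
    gaussianReal 0 1 s ≠ 0 := fun h =>
  hs (gaussianReal_absolutelyContinuous' 0 one_ne_zero h)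

/-- With a probability that does not depend on `u`, every noise component has the sign of the
corresponding component of `u` and is at least `1` in absolute value. -/
theorem exists_le_gaussian_dotProduct (n : ℕ) : ∃ q : ℝ≥0∞, q ≠ 0 ∧ ∀ u : Fin n → ℝ,
    q ≤ (Measure.pi fun _ : Fin n => gaussianReal 0 1) {w | √(sqNorm u) ≤ w ⬝ᵥ u} := by
  set q₀ := min (gaussianReal 0 1 (Set.Ici 1)) (gaussianReal 0 1 (Set.Iic (-1)))
  have hq₀ : q₀ ≠ 0 := by
    have h1 : gaussianReal 0 1 (Set.Ici 1) ≠ 0 := gaussianReal_pos_of_volume_pos (by simp)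
    have h2 : gaussianReal 0 1 (Set.Iic (-1)) ≠ 0 := gaussianReal_pos_of_volume_pos (by simp)
    exact (lt_min (pos_iff_ne_zero.2 h1) (pos_iff_ne_zero.2 h2)).ne'
  refine ⟨q₀ ^ n, pow_ne_zero _ hq₀, fun u => ?_⟩
  let T : Fin n → Set ℝ := fun i => if 0 ≤ u i then Set.Ici 1 else Set.Iic (-1)
  have hsub : Set.univ.pi T ⊆ {w | √(sqNorm u) ≤ w ⬝ᵥ u} := by
    intro w hw
    have h1 : ∀ i, |u i| ≤ w i * u i := by
      intro i
      have hi := hw i (Set.mem_univ i)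
      by_cases hu : 0 ≤ u i
      · simp only [T, if_pos hu, Set.mem_Ici] at hi
        rw [abs_of_nonneg hu]; nlinarith
      · simp only [T, if_neg hu, Set.mem_Iic] at hi
        rw [abs_of_neg (not_le.1 hu)]; nlinarith
    have h2 : √(sqNorm u) ≤ ∑ i, |u i| := by
      rw [Real.sqrt_le_left (Finset.sum_nonneg fun _ _ => abs_nonneg _)]
      have := Finset.sum_sq_le_sq_sum_of_nonneg (s := Finset.univ) (f := fun i => |u i|)
        fun _ _ => abs_nonneg _
      simpa [sqNorm] using this
    exact h2.trans (Finset.sum_le_sum fun i _ => h1 i)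
  refine le_trans ?_ (measure_mono hsub)
  rw [Measure.pi_pi]
  calc q₀ ^ n = ∏ _i : Fin n, q₀ := by simp
    _ ≤ _ := Finset.prod_le_prod' fun i _ => by
      by_cases hu : 0 ≤ u i
      · simp only [T, if_pos hu]; exact min_le_left _ _
      · simp only [T, if_neg hu]; exact min_le_right _ _

theorem gaussianReal_abs_ge_le {t : ℝ} (ht : 0 ≤ t) :
    (gaussianReal 0 1).real {x | t ≤ |x|} ≤ 2 * Real.exp (-t ^ 2 / 2) := by
  have h1 : (gaussianReal 0 1).real {x | t ≤ x} ≤ Real.exp (-t ^ 2 / 2) := by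
    refine (measure_ge_le_exp_mul_mgf (X := id) t ht
      (integrable_exp_mul_gaussianReal t)).trans_eq ?_
    rw [mgf_id_gaussianReal, ← Real.exp_add]
    congr 1; simp; ring
  have h2 : (gaussianReal 0 1).real {x | x ≤ -t} ≤ Real.exp (-t ^ 2 / 2) := by
    refine (measure_le_le_exp_mul_mgf (X := id) (t := -t) (-t) (by linarith)
      (integrable_exp_mul_gaussianReal (-t))).trans_eq ?_
    rw [mgf_id_gaussianReal, ← Real.exp_add]
    congr 1; simp; ring
  have hsub : {x : ℝ | t ≤ |x|} ⊆ {x | t ≤ x} ∪ {x | x ≤ -t} := fun x hx => by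
    rcases le_abs.1 (show t ≤ |x| from hx) with h | h
    · exact Or.inl h
    · exact Or.inr (show x ≤ -t by linarith)
  calc _ ≤ _ := measureReal_mono hsub
    _ ≤ _ := measureReal_union_le _ _
    _ ≤ _ := by linarith

theorem gaussian_sqNorm_gt_le {t : ℝ} (ht : 0 ≤ t) :
    (Measure.pi fun _ : Fin n => gaussianReal 0 1).real {w | n * t ^ 2 < sqNorm w} ≤
      n * (2 * Real.exp (-t ^ 2 / 2)) := by
  have hsub : {w : Fin n → ℝ | n * t ^ 2 < sqNorm w} ⊆
      ⋃ i : Fin n, (fun w : Fin n → ℝ => w i) ⁻¹' {x | t ≤ |x|} := by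
    intro w hw
    by_contra hno
    simp only [Set.mem_iUnion, Set.mem_preimage, Set.mem_ofPred_eq, not_exists, not_le] at hno
    have h1 : sqNorm w ≤ ∑ _i : Fin n, t ^ 2 :=
      Finset.sum_le_sum fun i _ => by
        rw [← sq_abs]; exact pow_le_pow_left₀ (abs_nonneg _) (hno i).le 2
    simp only [Finset.sum_const, Finset.card_univ, Fintype.card_fin, nsmul_eq_mul] at h1
    exact absurd hw.out (not_lt.2 h1)
  calc _ ≤ _ := measureReal_mono hsub
    _ ≤ ∑ i : Fin n, (Measure.pi fun _ : Fin n => gaussianReal 0 1).real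
        ((fun w : Fin n → ℝ => w i) ⁻¹' {x | t ≤ |x|}) := measureReal_iUnion_fintype_le _
    _ ≤ ∑ _i : Fin n, 2 * Real.exp (-t ^ 2 / 2) := Finset.sum_le_sum fun i _ => by
        have hm : MeasurableSet {x : ℝ | t ≤ |x|} :=
          measurableSet_le measurable_const (by fun_prop)
        have := (measurePreserving_eval (fun _ : Fin n => gaussianReal 0 1) i).measureReal_preimage
          hm.nullMeasurableSet
        refine (this.trans_le ?_)
        exact gaussianReal_abs_ge_le ht
    _ = _ := by simp

end Gaussian

/-! ### Symbol vectors in a dilated region -/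

section Symbols

variable {κ : ℕ}

theorem one_le_sqNorm_intVec {v : Fin κ → ℤ} (hv : v ≠ 0) : 1 ≤ sqNorm (intVec v) := by
  obtain ⟨i, hi⟩ := Function.ne_iff.1 hv
  refine le_trans ?_ (sq_le_sqNorm _ i)
  have : 1 ≤ (v i) ^ 2 := by
    have := sq_pos_of_ne_zero (show v i ≠ 0 from hi)
    omega
  show (1 : ℝ) ≤ (v i : ℝ) ^ 2
  exact_mod_cast this

theorem exists_bound_of_isCompact {region : Set (Fin κ → ℝ)} (hc : IsCompact region) :
    ∃ K : ℝ, 1 ≤ K ∧ ∀ x ∈ region, ∀ i, |x i| ≤ K := by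
  obtain ⟨K, hK⟩ := hc.isBounded.exists_norm_le
  refine ⟨max K 1, le_max_right _ _, fun x hx i => ?_⟩
  exact (norm_le_pi_norm x i).trans ((hK x hx).trans (le_max_left _ _))

theorem symbols_subset_piFinset {region : Set (Fin κ → ℝ)} {K : ℝ}
    (hK : ∀ x ∈ region, ∀ i, |x i| ≤ K) {X : ℝ} (hX : 0 < X) :
    {s : Fin κ → ℤ | intVec s ∈ X • region} ⊆
      ↑(Fintype.piFinset fun _ : Fin κ => Finset.Icc (-⌊X * K⌋) ⌊X * K⌋) := by
  intro s hs
  rw [Set.mem_ofPred_eq, Set.mem_smul_set_iff_inv_smul_mem₀ hX.ne'] at hs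
  simp only [Finset.mem_coe, Fintype.mem_piFinset, Finset.mem_Icc]
  intro i
  have h := hK _ hs i
  have h' : |(s i : ℝ)| ≤ X * K := by
    rw [Pi.smul_apply, smul_eq_mul, abs_mul, abs_inv, abs_of_pos hX, inv_mul_le_iff₀ hX] at h
    exact h
  rw [abs_le] at h'
  have h1 := Int.le_floor.2 h'.2
  have h2 : -s i ≤ ⌊X * K⌋ := Int.le_floor.2 (by push_cast; linarith)
  omega

/-- In a dilated convex body a positive fraction of the lattice points `s` satisfies
`‖v‖² < |⟨s, v⟩|`, uniformly over the lattice vectors `v` that are short relative to the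
dilation: of the two points `s` and `s + 3 v`, at least one does. -/
theorem exists_le_uniformOn_large_inner {region : Set (Fin κ → ℝ)} (hc : IsCompact region)
    (hint : (interior region).Nonempty) :
    ∃ θ : ℝ, 0 < θ ∧ θ ≤ 1 ∧ ∃ c : ℝ, 0 < c ∧ ∀ X : ℝ, 0 < X → ∀ v : Fin κ → ℤ, v ≠ 0 →
      sqNorm (intVec v) ≤ θ * X ^ 2 →
      ENNReal.ofReal c ≤ uniformOn {s : Fin κ → ℤ | intVec s ∈ X • region}
        {s | sqNorm (intVec v) < |intVec s ⬝ᵥ intVec v|} := by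
  classical
  obtain ⟨K, hK1, hK⟩ := exists_bound_of_isCompact hc
  obtain ⟨x₀, hx₀⟩ := hint
  obtain ⟨η, hη, hη1, hball⟩ : ∃ η : ℝ, 0 < η ∧ η ≤ 1 ∧ Metric.closedBall x₀ η ⊆ region := by
    obtain ⟨ε, hε, hsub⟩ := Metric.nhds_basis_closedBall.mem_iff.1 (mem_interior_iff_mem_nhds.1 hx₀)
    exact ⟨min ε 1, lt_min hε one_pos, min_le_right _ _,
      (Metric.closedBall_subset_closedBall (min_le_left _ _)).trans hsub⟩
  refine ⟨(η / 6) ^ 2, by positivity, by nlinarith, (η / (6 * K)) ^ κ / 2, by positivity,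
    fun X hX v hv hvX => ?_⟩
  have hX6 : 6 ≤ X * η := by
    have h1 : (1 : ℝ) ^ 2 ≤ (η / 6 * X) ^ 2 := by
      rw [mul_pow, one_pow]; exact (one_le_sqNorm_intVec hv).trans hvX
    have := le_of_sq_le_sq h1 (by positivity)
    linarith
  have hX1 : 1 ≤ X := by nlinarith
  set S : Set (Fin κ → ℤ) := {s | intVec s ∈ X • region} with hS
  have hfin : S.Finite := (Finset.finite_toSet _).subset (symbols_subset_piFinset hK hX)
  set Sf := hfin.toFinset
  set good : (Fin κ → ℤ) → Prop := fun s => sqNorm (intVec v) < |intVec s ⬝ᵥ intVec v|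
  -- The lattice points of a cube of half the size of one that the body contains.
  set Q := Fintype.piFinset fun i : Fin κ =>
    Finset.Icc ⌈X * x₀ i - X * η / 2⌉ ⌊X * x₀ i + X * η / 2⌋
  have hmemS : ∀ s : Fin κ → ℤ, (∀ i, |(s i : ℝ) - X * x₀ i| ≤ X * η) → s ∈ S := by
    intro s hs
    rw [hS, Set.mem_ofPred_eq, Set.mem_smul_set_iff_inv_smul_mem₀ hX.ne']
    refine hball ?_
    rw [Metric.mem_closedBall, dist_pi_le_iff hη.le]
    intro i
    have h1 : (X⁻¹ • intVec s) i - x₀ i = X⁻¹ * ((s i : ℝ) - X * x₀ i) := by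
      simp only [Pi.smul_apply, smul_eq_mul, intVec]; field_simp
    rw [Real.dist_eq, h1, abs_mul, abs_inv, abs_of_pos hX, inv_mul_le_iff₀ hX]
    exact hs i
  have hQ : ∀ s ∈ Q, ∀ i, |(s i : ℝ) - X * x₀ i| ≤ X * η / 2 := by
    intro s hs i
    have h := Fintype.mem_piFinset.1 hs i
    rw [Finset.mem_Icc, Int.ceil_le, Int.le_floor] at h
    rw [abs_le]; constructor <;> linarith [h.1, h.2]
  have hv3 : ∀ i, |(3 * v i : ℝ)| ≤ X * η / 2 := by
    intro i
    have h1 : |(v i : ℝ)| ≤ η / 6 * X := by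
      refine abs_le_of_sq_le_sq ?_ (by positivity)
      rw [mul_pow]
      exact (sq_le_sqNorm (intVec v) i).trans hvX
    rw [abs_mul, abs_of_pos (by norm_num : (0 : ℝ) < 3)]
    linarith
  have hgood : ∀ s, ¬ good s → good (s + (3 : ℤ) • v) := by
    intro s hs
    have h1 : intVec (s + (3 : ℤ) • v) ⬝ᵥ intVec v =
        intVec s ⬝ᵥ intVec v + 3 * sqNorm (intVec v) := by
      have : (intVec (s + (3 : ℤ) • v) : Fin κ → ℝ) = intVec s + (3 : ℝ) • intVec v := by
        funext i; simp [intVec]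
      rw [this, add_dotProduct, smul_dotProduct, sqNorm_eq_dotProduct, smul_eq_mul]
    have h2 := abs_le.1 (not_lt.1 hs)
    have h3 := one_le_sqNorm_intVec hv
    simp only [good]
    rw [h1]
    exact lt_of_lt_of_le (by linarith) (le_abs_self _)
  set Gd := Sf.filter good
  have hcard1 : Q.card ≤ 2 * Gd.card := by
    rw [← Finset.card_filter_add_card_filter_not (s := Q) good, two_mul]
    refine Nat.add_le_add (Finset.card_le_card fun s hs => ?_)
      (Finset.card_le_card_of_injOn (fun s => s + (3 : ℤ) • v) (fun s hs => ?_)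
        (fun a _ b _ h => by simpa using h))
    · rw [Finset.mem_filter] at hs ⊢
      refine ⟨hfin.mem_toFinset.2 (hmemS s fun i => ?_), hs.2⟩
      have := hQ s hs.1 i
      linarith [mul_pos hX hη]
    · rw [Finset.mem_coe, Finset.mem_filter] at hs
      rw [Finset.mem_coe, Finset.mem_filter]
      refine ⟨hfin.mem_toFinset.2 (hmemS _ fun i => ?_), hgood s hs.2⟩
      have h1 := hQ s hs.1 i
      have h2 := hv3 i
      have h3 : (((s + (3 : ℤ) • v) i : ℤ) : ℝ) - X * x₀ i =
          ((s i : ℝ) - X * x₀ i) + 3 * v i := by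
        simp only [Pi.add_apply, Pi.smul_apply, smul_eq_mul]; push_cast; ring
      rw [h3]
      exact (abs_add_le _ _).trans (by linarith)
  have hcard2 : (X * η / 2) ^ κ ≤ (Q.card : ℝ) := by
    rw [Fintype.card_piFinset, Nat.cast_prod]
    calc (X * η / 2) ^ κ = ∏ _i : Fin κ, (X * η / 2) := by
          rw [Finset.prod_const, Finset.card_univ, Fintype.card_fin]
      _ ≤ _ := Finset.prod_le_prod (fun _ _ => by positivity) fun i _ => by
        rw [Int.card_Icc]
        have h1 := Int.ceil_lt_add_one (X * x₀ i - X * η / 2)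
        have h2 := Int.lt_floor_add_one (X * x₀ i + X * η / 2)
        have h3 : ((⌊X * x₀ i + X * η / 2⌋ + 1 - ⌈X * x₀ i - X * η / 2⌉ : ℤ) : ℝ) ≤
            ((⌊X * x₀ i + X * η / 2⌋ + 1 - ⌈X * x₀ i - X * η / 2⌉).toNat : ℝ) := by
          exact_mod_cast Int.self_le_toNat _
        push_cast at h3
        linarith
  have hcard3 : (Sf.card : ℝ) ≤ (3 * (X * K)) ^ κ := by
    have h1 : Sf.card ≤ (Fintype.piFinset fun _ : Fin κ =>
        Finset.Icc (-⌊X * K⌋) ⌊X * K⌋).card := by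
      refine Finset.card_le_card fun s hs => ?_
      exact Finset.mem_coe.1 (symbols_subset_piFinset hK hX (hfin.mem_toFinset.1 hs))
    have h2 : (1 : ℝ) ≤ X * K := by nlinarith
    have hfl : (0 : ℤ) ≤ ⌊X * K⌋ := Int.floor_nonneg.2 (by linarith)
    calc (Sf.card : ℝ) ≤ ((Fintype.piFinset fun _ : Fin κ =>
          Finset.Icc (-⌊X * K⌋) ⌊X * K⌋).card : ℝ) := by exact_mod_cast h1
      _ = ∏ _i : Fin κ, (((⌊X * K⌋ + 1 - -⌊X * K⌋).toNat : ℕ) : ℝ) := by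
        rw [Fintype.card_piFinset, Nat.cast_prod]; simp only [Int.card_Icc]
      _ ≤ ∏ _i : Fin κ, (3 * (X * K)) := Finset.prod_le_prod (fun _ _ => by positivity)
        fun i _ => by
          have h3 : (((⌊X * K⌋ + 1 - -⌊X * K⌋).toNat : ℕ) : ℝ) =
              ((⌊X * K⌋ + 1 - -⌊X * K⌋ : ℤ) : ℝ) := by
            have := Int.toNat_of_nonneg (a := ⌊X * K⌋ + 1 - -⌊X * K⌋) (by omega)
            exact_mod_cast congrArg (fun z : ℤ => (z : ℝ)) this
          rw [h3]
          have := Int.floor_le (X * K)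
          push_cast
          linarith
      _ = _ := by simp
  have hset : S ∩ {s | sqNorm (intVec v) < |intVec s ⬝ᵥ intVec v|} = ↑Gd := by
    ext s
    simp only [Gd, Finset.coe_filter, Set.mem_inter_iff, Set.mem_ofPred_eq, Sf,
      Set.Finite.mem_toFinset, good]
  have hSf : (Sf : Set (Fin κ → ℤ)) = S := hfin.coe_toFinset
  have hSpos : 0 < Sf.card := by
    have h1 : (0 : ℝ) < Q.card := lt_of_lt_of_le (by positivity) hcard2
    have h2 : 0 < Q.card := by exact_mod_cast h1
    have h3 : Gd.card ≤ Sf.card := Finset.card_filter_le _ _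
    omega
  have hsubset : Gd ⊆ Sf := Finset.filter_subset _ _
  rw [← uniformOn_inter_self hfin, hset, ← hSf, uniformOn_apply_finset,
    Finset.inter_eq_right.2 hsubset, ENNReal.le_div_iff_mul_le
      (Or.inl (by exact_mod_cast hSpos.ne')) (Or.inl (ENNReal.natCast_ne_top _)),
    ← ENNReal.ofReal_natCast, ← ENNReal.ofReal_natCast, ← ENNReal.ofReal_mul (by positivity)]
  apply ENNReal.ofReal_le_ofReal
  calc (η / (6 * K)) ^ κ / 2 * (Sf.card : ℝ) ≤ (η / (6 * K)) ^ κ / 2 * (3 * (X * K)) ^ κ :=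
        mul_le_mul_of_nonneg_left hcard3 (by positivity)
    _ = (X * η / 2) ^ κ / 2 := by
        rw [div_mul_eq_mul_div, ← mul_pow]
        congr 2
        field_simp; ring
    _ ≤ (Q.card : ℝ) / 2 := by linarith
    _ ≤ (Gd.card : ℝ) := by
        have : (Q.card : ℝ) ≤ 2 * Gd.card := by exact_mod_cast hcard1
        linarith

end Symbols

/-! ### Short lattice vectors make the exact decoder err -/

namespace LatticeLink

variable {m n κ : ℕ} (L : LatticeLink m n κ)

/-- The squared length of the lattice vector `R v`. -/
noncomputable def latticeSq (r ρ : ℝ) (H : Matrix (Fin n) (Fin m) ℝ) (v : Fin κ → ℤ) : ℝ :=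
  sqNorm (L.codeChannel r ρ H *ᵥ intVec v) + L.alpha r ρ ^ 2 * sqNorm (intVec v)

/-- The channels for which the preprocessed lattice has a nonzero vector of squared length at most
`ℓ`. -/
def shortVectorEvent (r ρ ℓ : ℝ) : Set (Fin n → Fin m → ℝ) :=
  {H | ∃ v : Fin κ → ℤ, v ≠ 0 ∧ L.latticeSq r ρ H v ≤ ℓ}

theorem finite_symbols (r : ℝ) {ρ : ℝ} (hρ : 0 < ρ) : (L.symbols r ρ).Finite := by
  obtain ⟨K, -, hK⟩ := exists_bound_of_isCompact L.region_compact
  exact (Finset.finite_toSet _).subset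
    (symbols_subset_piFinset hK (Real.rpow_pos_of_pos hρ _))

theorem symbols_nonempty (r ρ : ℝ) : (L.symbols r ρ).Nonempty := by
  refine ⟨0, 0, L.region_zero, ?_⟩
  funext i; simp [intVec]

theorem isProbabilityMeasure_law (r : ℝ) {ρ : ℝ} (hρ : 0 < ρ) :
    IsProbabilityMeasure (L.law r ρ) := by
  have := L.fading_prob ρ
  have := isProbabilityMeasure_uniformOn (L.finite_symbols r hρ) (L.symbols_nonempty r ρ)
  rw [law]
  infer_instance

theorem codeChannel_mulVec_apply (r ρ : ℝ) (H : Matrix (Fin n) (Fin m) ℝ) (x : Fin κ → ℝ)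
    (i : Fin n) : (L.codeChannel r ρ H *ᵥ x) i =
      ρ ^ (1 / 2 - L.scaleExp r) * ∑ j, H i j * (L.G *ᵥ x) j := by
  rw [codeChannel, Matrix.smul_mulVec, ← Matrix.mulVec_mulVec, Pi.smul_apply, smul_eq_mul]
  rfl

theorem measurable_codeChannel_mulVec (r ρ : ℝ) (x : Fin κ → ℝ) (i : Fin n) :
    Measurable fun H : Fin n → Fin m → ℝ => (L.codeChannel r ρ H *ᵥ x) i := by
  have h : Measurable fun H : Fin n → Fin m → ℝ =>
      ρ ^ (1 / 2 - L.scaleExp r) * ∑ j, H i j * (L.G *ᵥ x) j := by fun_prop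
  convert! h using 2 with H
  exact L.codeChannel_mulVec_apply r ρ H x i

/-- The set where adding `v` to the transmitted point gives a better lattice point. -/
def beatenBy (r ρ : ℝ) (v : Fin κ → ℤ) :
    Set ((Fin κ → ℤ) × (Fin n → Fin m → ℝ) × (Fin n → ℝ)) :=
  {ω | L.latticeSq r ρ ω.2.1 v < 2 * (ω.2.2 ⬝ᵥ (L.codeChannel r ρ ω.2.1 *ᵥ intVec v) -
    L.alpha r ρ ^ 2 * (intVec ω.1 ⬝ᵥ intVec v))}

theorem measurableSet_beatenBy (r ρ : ℝ) (v : Fin κ → ℤ) :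
    MeasurableSet (L.beatenBy r ρ v) := by
  have h1 : ∀ i, Measurable fun ω : (Fin κ → ℤ) × (Fin n → Fin m → ℝ) × (Fin n → ℝ) =>
      (L.codeChannel r ρ ω.2.1 *ᵥ intVec v) i := fun i =>
    (L.measurable_codeChannel_mulVec r ρ (intVec v) i).comp (by fun_prop)
  have h2 : ∀ i, Measurable fun ω : (Fin κ → ℤ) × (Fin n → Fin m → ℝ) × (Fin n → ℝ) =>
      (intVec ω.1 i : ℝ) := fun i =>
    (measurable_of_countable fun s : Fin κ → ℤ => (intVec s i : ℝ)).comp measurable_fst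
  refine measurableSet_lt ?_ ?_
  · simp only [latticeSq, sqNorm]
    fun_prop
  · simp only [dotProduct]
    fun_prop

theorem beatenBy_of_large_inner (r ρ : ℝ) {s v : Fin κ → ℤ} {H : Fin n → Fin m → ℝ}
    {w : Fin n → ℝ} (hρ : 0 < ρ) (hM : sqNorm (L.codeChannel r ρ H *ᵥ intVec v) ≤ 1)
    (hs : sqNorm (intVec v) < -(intVec s ⬝ᵥ intVec v))
    (hw : √(sqNorm (L.codeChannel r ρ H *ᵥ intVec v)) ≤
      w ⬝ᵥ (L.codeChannel r ρ H *ᵥ intVec v)) :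
    (s, H, w) ∈ L.beatenBy r ρ v := by
  have hα := L.alpha_pos r hρ
  have h0 := sqNorm_nonneg (L.codeChannel r ρ H *ᵥ intVec v)
  have h0' := sqNorm_nonneg (intVec v)
  have h1 : sqNorm (L.codeChannel r ρ H *ᵥ intVec v) ≤
      √(sqNorm (L.codeChannel r ρ H *ᵥ intVec v)) := by
    apply Real.le_sqrt_of_sq_le
    nlinarith
  have h2 := mul_lt_mul_of_pos_left hs (pow_pos hα 2)
  have h3 : 0 ≤ L.alpha r ρ ^ 2 * sqNorm (intVec v) := by positivity
  simp only [beatenBy, latticeSq, Set.mem_ofPred_eq]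
  linarith

/-- If the preprocessed lattice has a sufficiently short nonzero vector then the exact decoder errs
with a probability bounded below: either the noise along this vector or the regularisation bias
drives it to a neighbouring point. -/
theorem exists_mul_shortVectorEvent_le {tie : Set (Fin κ → ℤ) → (Fin κ → ℤ)}
    (htie : ∀ A, A.Nonempty → tie A ∈ A) :
    ∃ θ : ℝ, 0 < θ ∧ ∃ p : ℝ, 0 < p ∧ ∀ r ρ : ℝ, 0 < ρ →
      p * (L.fading ρ).real (L.shortVectorEvent r ρ θ) ≤ L.exactError tie r ρ := by
  obtain ⟨θ, hθ, hθ1, c, hc, hgood⟩ :=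
    exists_le_uniformOn_large_inner L.region_compact L.region_interior
  obtain ⟨q, hq, hgauss⟩ := exists_le_gaussian_dotProduct n
  have hq1 : q ≤ 1 := (hgauss 0).trans prob_le_one
  have hqtop : q ≠ ⊤ := ne_top_of_le_ne_top ENNReal.one_ne_top hq1
  refine ⟨θ, hθ, (q * ENNReal.ofReal c).toReal, ENNReal.toReal_pos
    (mul_ne_zero hq (by simpa using hc)) (ENNReal.mul_ne_top hqtop ENNReal.ofReal_ne_top),
    fun r ρ hρ => ?_⟩
  have := L.fading_prob ρ
  have := L.isProbabilityMeasure_law r hρ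
  have := isProbabilityMeasure_uniformOn (L.finite_symbols r hρ) (L.symbols_nonempty r ρ)
  set γ : Measure (Fin n → ℝ) := Measure.pi fun _ : Fin n => gaussianReal 0 1
  set E : Set ((Fin κ → ℤ) × (Fin n → Fin m → ℝ) × (Fin n → ℝ)) := ⋃ v, L.beatenBy r ρ v
  have hE : MeasurableSet E := MeasurableSet.iUnion fun v => L.measurableSet_beatenBy r ρ v
  have hEerr : E ⊆ {ω | L.exactDecoder tie r ρ ω.2.1 (L.received r ρ ω.1 ω.2.1 ω.2.2) ≠ ω.1} := by
    intro ω hω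
    obtain ⟨v, hv⟩ := Set.mem_iUnion.1 hω
    exact L.exactDecoder_ne r ω.2.1 hρ htie hv
  have hmeas : Measurable (Function.uncurry fun (s : Fin κ → ℤ) (H : Fin n → Fin m → ℝ) =>
      γ (Prod.mk H ⁻¹' (Prod.mk s ⁻¹' E))) :=
    measurable_measure_prodMk_left (ν := γ)
      (s := (fun x : ((Fin κ → ℤ) × (Fin n → Fin m → ℝ)) × (Fin n → ℝ) =>
        (x.1.1, x.1.2, x.2)) ⁻¹' E) (hE.preimage (by fun_prop))
  have hlaw : L.law r ρ E = ∫⁻ H, ∫⁻ s, γ (Prod.mk H ⁻¹' (Prod.mk s ⁻¹' E))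
      ∂(uniformOn (L.symbols r ρ)) ∂(L.fading ρ) := by
    rw [law, Measure.prod_apply hE, ← lintegral_lintegral_swap hmeas.aemeasurable]
    refine lintegral_congr fun s => ?_
    rw [Measure.prod_apply (hE.preimage measurable_prodMk_left)]
  have hinner : ∀ H ∈ L.shortVectorEvent r ρ θ, q * ENNReal.ofReal c ≤
      ∫⁻ s, γ (Prod.mk H ⁻¹' (Prod.mk s ⁻¹' E)) ∂(uniformOn (L.symbols r ρ)) := by
    rintro H ⟨v, hv, hvθ⟩
    have h0 := sqNorm_nonneg (L.codeChannel r ρ H *ᵥ intVec v)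
    have h0' : 0 ≤ L.alpha r ρ ^ 2 * sqNorm (intVec v) :=
      mul_nonneg (sq_nonneg _) (sqNorm_nonneg _)
    replace hvθ : sqNorm (L.codeChannel r ρ H *ᵥ intVec v) +
      L.alpha r ρ ^ 2 * sqNorm (intVec v) ≤ θ := hvθ
    have hM : sqNorm (L.codeChannel r ρ H *ᵥ intVec v) ≤ 1 := by linarith
    have hX : sqNorm (intVec v) ≤ θ * (ρ ^ L.scaleExp r) ^ 2 := by
      have h1 : L.alpha r ρ * ρ ^ L.scaleExp r = 1 := by
        rw [alpha, ← Real.rpow_add hρ, neg_add_cancel, Real.rpow_zero]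
      have h2 : sqNorm (intVec v) =
          (L.alpha r ρ ^ 2 * sqNorm (intVec v)) * (ρ ^ L.scaleExp r) ^ 2 := by
        have : (L.alpha r ρ * ρ ^ L.scaleExp r) ^ 2 = 1 := by rw [h1, one_pow]
        linear_combination (-sqNorm (intVec v)) * this
      rw [h2]
      exact mul_le_mul_of_nonneg_right (by linarith) (sq_nonneg _)
    have hfrac := hgood _ (Real.rpow_pos_of_pos hρ (L.scaleExp r)) v hv hX
    have hsub : {s : Fin κ → ℤ | sqNorm (intVec v) < |intVec s ⬝ᵥ intVec v|} ⊆
        {s | q ≤ γ (Prod.mk H ⁻¹' (Prod.mk s ⁻¹' E))} := by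
      intro s hs
      -- The sign of `v` is chosen so that the bias points towards the competing lattice point.
      have key : ∀ v' : Fin κ → ℤ, sqNorm (L.codeChannel r ρ H *ᵥ intVec v') ≤ 1 →
          sqNorm (intVec v') < -(intVec s ⬝ᵥ intVec v') →
          q ≤ γ (Prod.mk H ⁻¹' (Prod.mk s ⁻¹' E)) := fun v' h1 h2 =>
        (hgauss (L.codeChannel r ρ H *ᵥ intVec v')).trans (measure_mono fun w hw =>
          Set.mem_iUnion.2 ⟨v', L.beatenBy_of_large_inner r ρ hρ h1 h2 hw⟩)
      rcases lt_abs.1 hs.out with h | h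
      · have hneg : (intVec (-v) : Fin κ → ℝ) = -intVec v := by
          funext i; simp [intVec]
        have hsq : ∀ {ι : Type} [Fintype ι] (x : ι → ℝ), sqNorm (-x) = sqNorm x := by
          intro ι _ x; simp [sqNorm]
        refine key (-v) ?_ ?_
        · rwa [hneg, Matrix.mulVec_neg, hsq]
        · rwa [hneg, hsq, dotProduct_neg, neg_neg]
      · exact key v hM h
    calc q * ENNReal.ofReal c ≤ q * uniformOn (L.symbols r ρ)
          {s | q ≤ γ (Prod.mk H ⁻¹' (Prod.mk s ⁻¹' E))} :=
          mul_le_mul_right (hfrac.trans (measure_mono hsub)) _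
      _ ≤ _ := mul_meas_ge_le_lintegral (measurable_of_countable _) q
  have hmain : (q * ENNReal.ofReal c) * L.fading ρ (L.shortVectorEvent r ρ θ) ≤
      L.law r ρ {ω | L.exactDecoder tie r ρ ω.2.1 (L.received r ρ ω.1 ω.2.1 ω.2.2) ≠ ω.1} := by
    refine le_trans ?_ (measure_mono hEerr)
    rw [hlaw]
    refine le_trans (mul_le_mul_right (measure_mono hinner) _) ?_
    exact mul_meas_ge_le_lintegral hmeas.lintegral_prod_left _
  rw [Measure.real, ← ENNReal.toReal_mul]
  exact ENNReal.toReal_mono (measure_ne_top _ _) hmain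

/-- Lowering the multiplexing gain scales the preprocessed lattice up. -/
theorem latticeSq_eq_rpow_mul (r r' : ℝ) {ρ : ℝ} (hρ : 0 < ρ) (H : Matrix (Fin n) (Fin m) ℝ)
    (v : Fin κ → ℤ) : L.latticeSq r' ρ H v =
      ρ ^ (2 * (L.scaleExp r - L.scaleExp r')) * L.latticeSq r ρ H v := by
  have h1 : L.codeChannel r' ρ H =
      ρ ^ (L.scaleExp r - L.scaleExp r') • L.codeChannel r ρ H := by
    rw [codeChannel, codeChannel, smul_smul, ← Real.rpow_add hρ]
    congr 2; ring
  have h2 : L.alpha r' ρ = ρ ^ (L.scaleExp r - L.scaleExp r') * L.alpha r ρ := by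
    rw [alpha, alpha, ← Real.rpow_add hρ]
    congr 1; ring
  have h3 : ρ ^ (2 * (L.scaleExp r - L.scaleExp r')) =
      (ρ ^ (L.scaleExp r - L.scaleExp r')) ^ 2 := by
    rw [← Real.rpow_natCast, ← Real.rpow_mul hρ.le, mul_comm]
    norm_num
  rw [latticeSq, latticeSq, h1, h2, h3, Matrix.smul_mulVec, sqNorm_smul]
  ring

end LatticeLink

/-! ### Diversity gains -/

section Diversity

theorem tendsto_div_zero_of_diversity_lt {P P' : ℝ → ℝ} {d d' : EReal}
    (h : HasDiversityGain P d) (h' : HasDiversityGain P' d') (hlt : d < d') :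
    Tendsto (fun ρ => P' ρ / P ρ) atTop (𝓝 0) := by
  obtain ⟨b, hdb, hbd⟩ := EReal.lt_iff_exists_real_btwn.1 hlt
  obtain ⟨b', hbb, hbd'⟩ := EReal.lt_iff_exists_real_btwn.1 hbd
  have hbb' : b < b' := by exact_mod_cast hbb
  have hlim : Tendsto (fun ρ : ℝ => ρ ^ (-(b' - b))) atTop (𝓝 0) :=
    tendsto_rpow_neg_atTop (sub_pos.2 hbb')
  refine tendsto_of_tendsto_of_tendsto_of_le_of_le' tendsto_const_nhds hlim ?_ ?_
  · filter_upwards [h.1, h'.1] with ρ h1 h2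
    positivity
  · filter_upwards [h.1, h'.1, h.2.eventually_lt_const hdb, h'.2.eventually_const_lt hbd',
      eventually_gt_atTop 1] with ρ h1 h2 h3 h4 hρ
    have hlog : 0 < Real.log ρ := Real.log_pos hρ
    have hρ0 : 0 < ρ := one_pos.trans hρ
    have h3' : -Real.log (P ρ) / Real.log ρ < b := by exact_mod_cast h3
    have h4' : b' < -Real.log (P' ρ) / Real.log ρ := by exact_mod_cast h4
    rw [div_lt_iff₀ hlog] at h3'
    rw [lt_div_iff₀ hlog] at h4'
    have h5 : ρ ^ (-b) ≤ P ρ := by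
      rw [Real.rpow_def_of_pos hρ0, ← Real.le_log_iff_exp_le h1]; linarith
    have h6 : P' ρ ≤ ρ ^ (-b') := by
      rw [Real.rpow_def_of_pos hρ0, ← Real.log_le_iff_le_exp h2]; linarith
    calc P' ρ / P ρ ≤ ρ ^ (-b') / ρ ^ (-b) :=
          div_le_div₀ (by positivity) h6 (by positivity) h5
      _ = ρ ^ (-(b' - b)) := by
          rw [← Real.rpow_sub hρ0]; congr 1; ring

theorem hasDiversityGain_rpow_neg (b : ℝ) : HasDiversityGain (fun ρ => ρ ^ (-b)) b := by
  refine ⟨?_, ?_⟩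
  · filter_upwards [eventually_gt_atTop 0] with ρ hρ
    exact Real.rpow_pos_of_pos hρ _
  · refine tendsto_const_nhds.congr' ?_
    filter_upwards [eventually_gt_atTop 1] with ρ hρ
    have hlog : Real.log ρ ≠ 0 := (Real.log_pos hρ).ne'
    rw [Real.log_rpow (one_pos.trans hρ), neg_mul, neg_neg, mul_div_assoc, div_self hlog, mul_one]

theorem nonneg_of_hasDiversityGain {P : ℝ → ℝ} {d : EReal} (h : HasDiversityGain P d)
    (hP : ∀ᶠ ρ in atTop, P ρ ≤ 1) : 0 ≤ d := by
  refine ge_of_tendsto h.2 ?_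
  filter_upwards [h.1, hP, eventually_gt_atTop 1] with ρ h1 h2 hρ
  have : 0 ≤ -Real.log (P ρ) / Real.log ρ :=
    div_nonneg (neg_nonneg.2 (Real.log_nonpos h1.le h2)) (Real.log_pos hρ).le
  exact_mod_cast this

/-- From a decoder whose gap vanishes for every timeout `ρ ^ x`, `x > 0`, a diagonal argument
yields a subpolynomial timeout with the same property. -/
theorem exists_subpolynomial_policy {f : ℝ → ℝ → ℝ}
    (h : ∀ x > (0 : ℝ), Tendsto (fun ρ : ℝ => f (ρ ^ x) ρ) atTop (𝓝 1)) :
    ∃ Nmax : ℝ → ℝ, (∀ᶠ ρ in atTop, 1 ≤ Nmax ρ) ∧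
      Tendsto (fun ρ => Real.log (Nmax ρ) / Real.log ρ) atTop (𝓝 0) ∧
      Tendsto (fun ρ => f (Nmax ρ) ρ) atTop (𝓝 1) := by
  classical
  let x : ℕ → ℝ := fun k => 1 / ((k : ℝ) + 1)
  have hx : ∀ k, 0 < x k := fun k => Nat.one_div_pos_of_nat
  let Q : ℝ → ℕ → Prop := fun ρ k => |f (ρ ^ x k) ρ - 1| < x k
  have hQ : ∀ k, ∀ᶠ ρ in atTop, Q ρ k := fun k => by
    have := (Metric.tendsto_nhds.1 (h (x k) (hx k))) (x k) (hx k)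
    simpa only [Real.dist_eq] using this
  -- The best precision reached at `ρ` among the first `⌊ρ⌋` candidates.
  let K : ℝ → ℕ := fun ρ => Nat.findGreatest (Q ρ) ⌊ρ⌋₊
  have hK : Tendsto K atTop atTop := by
    rw [tendsto_atTop]
    intro k
    filter_upwards [hQ k, eventually_ge_atTop (k : ℝ)] with ρ h1 h2
    exact Nat.le_findGreatest (Nat.le_floor h2) h1
  have hKQ : ∀ᶠ ρ in atTop, Q ρ (K ρ) := by
    filter_upwards [hQ 0] with ρ h1
    exact Nat.findGreatest_spec (Nat.zero_le _) h1
  have hxK : Tendsto (fun ρ => x (K ρ)) atTop (𝓝 0) :=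
    tendsto_one_div_add_atTop_nhds_zero_nat.comp hK
  refine ⟨fun ρ => ρ ^ x (K ρ), ?_, ?_, ?_⟩
  · filter_upwards [eventually_ge_atTop 1] with ρ hρ
    exact Real.one_le_rpow hρ (hx _).le
  · refine hxK.congr' ?_
    filter_upwards [eventually_gt_atTop 1] with ρ hρ
    rw [Real.log_rpow (one_pos.trans hρ), mul_div_assoc, div_self (Real.log_pos hρ).ne', mul_one]
  · rw [tendsto_iff_norm_sub_tendsto_zero]
    refine squeeze_zero' (Eventually.of_forall fun _ => norm_nonneg _) ?_ hxK
    filter_upwards [hKQ] with ρ h1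
    exact (Real.norm_eq_abs _).trans_le h1.le

theorem eventually_mul_rpow_half_lt (C : ℝ) {x : ℝ} (hx : 0 < x) :
    ∀ᶠ ρ : ℝ in atTop, C * ρ ^ (x / 2) < ρ ^ x := by
  filter_upwards [(tendsto_rpow_atTop (half_pos hx)).eventually_gt_atTop C,
    eventually_gt_atTop 0] with ρ h1 hρ
  have : ρ ^ x = ρ ^ (x / 2) * ρ ^ (x / 2) := by rw [← Real.rpow_add hρ, add_halves]
  rw [this]
  exact mul_lt_mul_of_pos_right h1 (Real.rpow_pos_of_pos hρ _)

theorem eventually_mul_log_le_rpow (C : ℝ) {x : ℝ} (hx : 0 < x) :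
    ∀ᶠ ρ : ℝ in atTop, C * Real.log ρ ≤ ρ ^ x := by
  have h := ((isLittleO_log_rpow_atTop hx).const_mul_left C).def one_pos
  filter_upwards [h, eventually_gt_atTop 0] with ρ h1 hρ
  rw [one_mul, Real.norm_of_nonneg (Real.rpow_nonneg hρ.le _)] at h1
  exact (le_abs_self _).trans h1

end Diversity

/-! ### Complexity and error probability of the LR-aided decoder -/

namespace LatticeLink

variable {m n κ : ℕ} (L : LatticeLink m n κ)

theorem scaleExp_nonneg {r : ℝ} (hr : 0 ≤ r) : 0 ≤ L.scaleExp r := by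
  rw [scaleExp]; positivity

theorem alpha_le_one {r : ℝ} (hr : 0 ≤ r) {ρ : ℝ} (hρ : 1 ≤ ρ) : L.alpha r ρ ≤ 1 :=
  Real.rpow_le_one_of_one_le_of_nonpos hρ (neg_nonpos.2 (L.scaleExp_nonneg hr))

theorem sqNorm_codeChannel_mulVec_le {r : ℝ} (hr : 0 ≤ r) {ρ : ℝ} (hρ : 1 ≤ ρ)
    (H : Matrix (Fin n) (Fin m) ℝ) (x : Fin κ → ℝ) :
    sqNorm (L.codeChannel r ρ H *ᵥ x) ≤ ρ * (∑ i, ∑ j, H i j ^ 2) * sqNorm (L.G *ᵥ x) := by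
  have hρ0 : 0 < ρ := one_pos.trans_le hρ
  have hc : (ρ ^ (1 / 2 - L.scaleExp r)) ^ 2 ≤ ρ := by
    rw [← Real.rpow_natCast, ← Real.rpow_mul hρ0.le]
    refine (Real.rpow_le_rpow_of_exponent_le hρ ?_).trans_eq (Real.rpow_one ρ)
    have := L.scaleExp_nonneg hr
    push_cast
    linarith
  rw [sqNorm, mul_assoc, Finset.sum_mul, Finset.mul_sum]
  refine Finset.sum_le_sum fun i _ => ?_
  rw [L.codeChannel_mulVec_apply, mul_pow]
  exact mul_le_mul hc (Finset.sum_mul_sq_le_sq_mul_sq _ _ _) (sq_nonneg _) hρ0.le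

theorem eventually_flops_lt (hκ : 0 < κ) {δ : ℝ} (hδ : 1 / 4 < δ) (hδ1 : δ < 1) {r : ℝ}
    (hr : 0 ≤ r) {A : ℝ} (hA : 0 ≤ A) (z : ℝ) (c : FlopCosts) {x ε : ℝ} (hx : 0 < x)
    (hε : 0 < ε) (hεx : ε * κ ≤ x / 2) :
    ∀ᶠ ρ : ℝ in atTop, ∀ H : Matrix (Fin n) (Fin m) ℝ, ∑ i, ∑ j, H i j ^ 2 ≤ ρ ^ A →
      H ∉ L.shortVectorEvent r ρ (ρ ^ (-ε)) → IsUnit (L.lrTransform δ r ρ H).det ∧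
        ∀ y, (L.flops c δ (searchRadius z ρ) r ρ H y : ℝ≥0∞) < ENNReal.ofReal (ρ ^ x) := by
  set g : ℝ := ∑ j, sqNorm (L.G *ᵥ Pi.single j 1) with hg
  have hg0 : 0 ≤ g := Finset.sum_nonneg fun _ _ => sqNorm_nonneg _
  set a := L.scaleExp r with ha
  have ha0 : 0 ≤ a := L.scaleExp_nonneg hr
  set l := -Real.log δ with hl
  have hl0 : 0 < l := neg_pos.2 (Real.log_neg (by linarith) hδ1)
  set B : ℝ := (A + 2 + 2 * a) * (κ * κ : ℕ) with hB
  have hB0 : 0 ≤ B := by positivity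
  set b := √((δ - 1 / 4) ^ κ) with hb
  have hb0 : 0 < b := Real.sqrt_pos.2 (pow_pos (by linarith) _)
  set C : ℝ := c.once + c.perLLLIteration * (2 * (B / l + 1) + κ) +
    c.perNode * (κ * (2 / b + 1) ^ κ) with hC
  filter_upwards [eventually_gt_atTop 1, eventually_ge_atTop (g + 1),
    eventually_mul_log_le_rpow z hε, eventually_mul_log_le_rpow 1 (half_pos hx),
    eventually_mul_rpow_half_lt C hx] with ρ hρ hρg hz hlogx hCx H hH hshort
  have hρ0 : 0 < ρ := one_pos.trans hρ
  have hlog : 0 < Real.log ρ := Real.log_pos hρ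
  set P := ⌊B * Real.log ρ / l⌋₊ + 1 with hP
  set ξ := searchRadius z ρ
  have hξ : 0 ≤ ξ := Real.sqrt_nonneg _
  have hdist : √((δ - 1 / 4) ^ κ * ρ ^ (-ε)) = b * ρ ^ (-(ε / 2)) := by
    rw [Real.sqrt_mul (pow_nonneg (by linarith) _), Real.sqrt_eq_rpow (ρ ^ (-ε)),
      ← Real.rpow_mul hρ0.le]
    congr 2; ring
  set N := ⌊2 * ξ / (b * ρ ^ (-(ε / 2)))⌋₊ with hN
  have hd0 : 0 < b * ρ ^ (-(ε / 2)) := mul_pos hb0 (Real.rpow_pos_of_pos hρ0 _)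
  have hNlt : 2 * ξ < √((δ - 1 / 4) ^ κ * ρ ^ (-ε)) * (N + 1) := by
    have := Nat.lt_floor_add_one (2 * ξ / (b * ρ ^ (-(ε / 2))))
    rw [hdist]
    rwa [div_lt_iff₀' hd0] at this
  have hX1 : 1 ≤ ρ ^ (A + 2) := Real.one_le_rpow hρ.le (by linarith)
  have hX : ∀ j, sqNorm (L.codeChannel r ρ H *ᵥ Pi.single j 1) + L.alpha r ρ ^ 2 ≤
      ρ ^ (A + 2) := by
    intro j
    have h1 := L.sqNorm_codeChannel_mulVec_le hr hρ.le H (Pi.single j 1)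
    have h2 : sqNorm (L.G *ᵥ Pi.single j 1) ≤ g :=
      Finset.single_le_sum (f := fun j => sqNorm (L.G *ᵥ Pi.single j 1))
        (fun _ _ => sqNorm_nonneg _) (Finset.mem_univ j)
    have h3 : L.alpha r ρ ^ 2 ≤ 1 :=
      pow_le_one₀ (L.alpha_pos r hρ0).le (L.alpha_le_one hr hρ.le)
    have h4 : 1 ≤ ρ ^ A := Real.one_le_rpow hρ.le hA
    have h5 : ρ ^ (A + 2) = ρ * ρ ^ A * ρ := by
      rw [Real.rpow_add hρ0]; norm_num; ring
    have h6 : ρ * (∑ i, ∑ j, H i j ^ 2) * sqNorm (L.G *ᵥ Pi.single j 1) ≤ ρ * ρ ^ A * g := by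
      gcongr
      exact sqNorm_nonneg _
    have h7 : 1 ≤ ρ * ρ ^ A := one_le_mul_of_one_le_of_one_le hρ.le h4
    rw [h5]
    calc _ ≤ ρ * ρ ^ A * g + ρ * ρ ^ A := by linarith
      _ = ρ * ρ ^ A * (g + 1) := by ring
      _ ≤ _ := mul_le_mul_of_nonneg_left hρg (by positivity)
  have hPlt : δ ^ P * (ρ ^ (A + 2)) ^ (κ * κ) < (L.alpha r ρ ^ 2) ^ (κ * κ) := by
    have h1 : B * Real.log ρ < P * l := by
      have := Nat.lt_floor_add_one (B * Real.log ρ / l)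
      rw [div_lt_iff₀ hl0] at this
      rw [hP]; push_cast; exact this
    have h2 : δ ^ P < ρ ^ (-B) := by
      rw [← Real.rpow_natCast, Real.rpow_def_of_pos (by linarith : 0 < δ),
        Real.rpow_def_of_pos hρ0, Real.exp_lt_exp]
      have : Real.log δ * P = -(P * l) := by rw [hl]; ring
      rw [this]; linarith
    have h3 : (ρ ^ (A + 2)) ^ (κ * κ) = ρ ^ ((A + 2) * (κ * κ : ℕ)) := by
      rw [← Real.rpow_natCast, ← Real.rpow_mul hρ0.le]
    have h4 : (L.alpha r ρ ^ 2) ^ (κ * κ) = ρ ^ (-B) * ρ ^ ((A + 2) * (κ * κ : ℕ)) := by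
      rw [alpha, ← pow_mul, ← Real.rpow_natCast, ← Real.rpow_mul hρ0.le, ← Real.rpow_add hρ0]
      congr 1
      rw [hB, ← ha]; push_cast; ring
    rw [h3, h4]
    exact mul_lt_mul_of_pos_right h2 (Real.rpow_pos_of_pos hρ0 _)
  have hmin : ∀ v : Fin κ → ℤ, v ≠ 0 → ρ ^ (-ε) <
      sqNorm (L.codeChannel r ρ H *ᵥ intVec v) + L.alpha r ρ ^ 2 * sqNorm (intVec v) := by
    intro v hv
    by_contra hle
    exact hshort ⟨v, hv, not_lt.1 hle⟩
  have key := fun y => L.flops_le r H hρ0 hκ hδ hδ1 (L.alpha_le_one hr hρ.le) hX1 hX hPlt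
    (Real.rpow_pos_of_pos hρ0 _) hmin hξ hNlt c y
  refine ⟨(key 0).1, fun y => ?_⟩
  refine lt_of_le_of_lt (ENat.toENNReal_le.2 (key y).2) ?_
  rw [ENat.toENNReal_coe, ENNReal.natCast_lt_ofReal]
  refine lt_of_le_of_lt ?_ hCx
  have hx1 : 1 ≤ ρ ^ (x / 2) := Real.one_le_rpow hρ.le (half_pos hx).le
  have hP' : (P : ℝ) ≤ (B / l + 1) * ρ ^ (x / 2) := by
    have h1 : (⌊B * Real.log ρ / l⌋₊ : ℝ) ≤ B * Real.log ρ / l := Nat.floor_le (by positivity)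
    have h2 : B * Real.log ρ / l ≤ B / l * ρ ^ (x / 2) := by
      rw [mul_div_right_comm]
      exact mul_le_mul_of_nonneg_left (by linarith) (by positivity)
    rw [hP]; push_cast; linarith
  have hN' : ((N : ℝ) + 1) ^ κ ≤ (2 / b + 1) ^ κ * ρ ^ (x / 2) := by
    have h1 : (N : ℝ) ≤ 2 * ξ / (b * ρ ^ (-(ε / 2))) := Nat.floor_le (by positivity)
    have h2 : ξ ≤ ρ ^ (ε / 2) := by
      refine (Real.sqrt_le_sqrt hz).trans_eq ?_
      rw [Real.sqrt_eq_rpow, ← Real.rpow_mul hρ0.le]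
      congr 1; ring
    have h3 : 2 * ξ / (b * ρ ^ (-(ε / 2))) ≤ 2 / b * ρ ^ ε := by
      rw [div_le_iff₀ hd0]
      have : 2 / b * ρ ^ ε * (b * ρ ^ (-(ε / 2))) = 2 * ρ ^ (ε / 2) := by
        have h4 : ρ ^ ε * ρ ^ (-(ε / 2)) = ρ ^ (ε / 2) := by
          rw [← Real.rpow_add hρ0]; congr 1; ring
        rw [← h4]; field_simp
      rw [this]; linarith
    have h4 : 1 ≤ ρ ^ ε := Real.one_le_rpow hρ.le hε.le
    calc ((N : ℝ) + 1) ^ κ ≤ ((2 / b + 1) * ρ ^ ε) ^ κ :=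
          pow_le_pow_left₀ (by positivity) (by linarith) _
      _ = (2 / b + 1) ^ κ * ρ ^ (ε * κ) := by
          rw [mul_pow, ← Real.rpow_natCast (ρ ^ ε), ← Real.rpow_mul hρ0.le]
      _ ≤ _ := by
          gcongr
          exact hρ.le
  push_cast
  have e1 : (c.once : ℝ) ≤ c.once * ρ ^ (x / 2) := le_mul_of_one_le_right (by positivity) hx1
  have e2 : (c.perLLLIteration : ℝ) * (2 * P + κ) ≤
      c.perLLLIteration * ((2 * (B / l + 1) + κ) * ρ ^ (x / 2)) := by
    have : (κ : ℝ) ≤ κ * ρ ^ (x / 2) := le_mul_of_one_le_right (by positivity) hx1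
    gcongr
    linarith
  have e3 : (c.perNode : ℝ) * (κ * ((N : ℝ) + 1) ^ κ) ≤
      c.perNode * (κ * ((2 / b + 1) ^ κ * ρ ^ (x / 2))) := by gcongr
  calc _ ≤ _ := add_le_add (add_le_add e1 e2) e3
    _ = C * ρ ^ (x / 2) := by rw [hC]; ring

/-- The regularisation bias is bounded, because the symbol vectors lie in a dilate of a bounded
region. -/
theorem exists_bias_le (r : ℝ) : ∃ K : ℝ, ∀ ρ : ℝ, 0 < ρ → ∀ s ∈ L.symbols r ρ,
    L.alpha r ρ ^ 2 * sqNorm (intVec s) ≤ K := by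
  obtain ⟨K, hK1, hK⟩ := exists_bound_of_isCompact L.region_compact
  refine ⟨κ * K ^ 2, fun ρ hρ s hs => ?_⟩
  have hX := Real.rpow_pos_of_pos hρ (L.scaleExp r)
  rw [symbols, Set.mem_ofPred_eq, Set.mem_smul_set_iff_inv_smul_mem₀ hX.ne',
    ← Real.rpow_neg hρ.le] at hs
  rw [← sqNorm_smul]
  calc sqNorm (L.alpha r ρ • intVec s) ≤ ∑ _i : Fin κ, K ^ 2 :=
        Finset.sum_le_sum fun i _ => by
          rw [← sq_abs]; exact pow_le_pow_left₀ (abs_nonneg _) (hK _ hs i) 2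
    _ = _ := by simp

/-- The two decoders have the same error event outside the union of three rare events: strong
noise, a large channel, and a short vector in the preprocessed lattice. -/
theorem abs_lrError_sub_exactError_le (tie : Set (Fin κ → ℤ) → (Fin κ → ℤ)) {c : FlopCosts}
    {δ ξ N r ρ A ℓ K t : ℝ} (hρ : 0 < ρ)
    (hK : ∀ s ∈ L.symbols r ρ, L.alpha r ρ ^ 2 * sqNorm (intVec s) ≤ K) (ht : 0 ≤ t)
    (hξ : n * t ^ 2 + K ≤ ξ ^ 2)
    (hflops : ∀ H : Matrix (Fin n) (Fin m) ℝ, ∑ i, ∑ j, H i j ^ 2 ≤ ρ ^ A →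
      H ∉ L.shortVectorEvent r ρ ℓ → IsUnit (L.lrTransform δ r ρ H).det ∧
        ∀ y, (L.flops c δ ξ r ρ H y : ℝ≥0∞) < ENNReal.ofReal N) :
    |L.lrError c tie δ ξ N r ρ - L.exactError tie r ρ| ≤
      n * (2 * Real.exp (-t ^ 2 / 2)) +
        (L.fading ρ).real {H | ρ ^ A < ∑ i, ∑ j, H i j ^ 2} +
        (L.fading ρ).real (L.shortVectorEvent r ρ ℓ) := by
  have := L.fading_prob ρ
  have := L.isProbabilityMeasure_law r hρ
  have := isProbabilityMeasure_uniformOn (L.finite_symbols r hρ) (L.symbols_nonempty r ρ)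
  set γ : Measure (Fin n → ℝ) := Measure.pi fun _ : Fin n => gaussianReal 0 1
  set E₀ : Set ((Fin κ → ℤ) × (Fin n → Fin m → ℝ) × (Fin n → ℝ)) :=
    (L.symbols r ρ)ᶜ ×ˢ Set.univ
  set E₁ : Set ((Fin κ → ℤ) × (Fin n → Fin m → ℝ) × (Fin n → ℝ)) :=
    Set.univ ×ˢ (Set.univ ×ˢ {w | n * t ^ 2 < sqNorm w})
  set E₂ : Set ((Fin κ → ℤ) × (Fin n → Fin m → ℝ) × (Fin n → ℝ)) :=
    Set.univ ×ˢ ({H | ρ ^ A < ∑ i, ∑ j, H i j ^ 2} ×ˢ Set.univ)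
  set E₃ : Set ((Fin κ → ℤ) × (Fin n → Fin m → ℝ) × (Fin n → ℝ)) :=
    Set.univ ×ˢ (L.shortVectorEvent r ρ ℓ ×ˢ Set.univ)
  have h0 : (L.law r ρ).real E₀ = 0 := by
    have h : uniformOn (L.symbols r ρ) (L.symbols r ρ)ᶜ = 0 := by
      rw [uniformOn_eq_zero_iff (L.finite_symbols r hρ), Set.inter_compl_self]
    rw [Measure.real, law, Measure.prod_prod, h, zero_mul, ENNReal.toReal_zero]
  have h1 : (L.law r ρ).real E₁ ≤ n * (2 * Real.exp (-t ^ 2 / 2)) := by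
    have : (L.law r ρ).real E₁ = γ.real {w | n * t ^ 2 < sqNorm w} := by
      rw [Measure.real, law, Measure.prod_prod, Measure.prod_prod, measure_univ, measure_univ,
        one_mul, one_mul, Measure.real]
    rw [this]
    exact gaussian_sqNorm_gt_le ht
  have h2 : (L.law r ρ).real E₂ = (L.fading ρ).real {H | ρ ^ A < ∑ i, ∑ j, H i j ^ 2} := by
    rw [Measure.real, law, Measure.prod_prod, Measure.prod_prod, measure_univ, measure_univ,
      one_mul, mul_one, Measure.real]
  have h3 : (L.law r ρ).real E₃ = (L.fading ρ).real (L.shortVectorEvent r ρ ℓ) := by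
    rw [Measure.real, law, Measure.prod_prod, Measure.prod_prod, measure_univ, measure_univ,
      one_mul, mul_one, Measure.real]
  have hbad : (L.law r ρ).real (E₀ ∪ E₁ ∪ E₂ ∪ E₃) ≤ n * (2 * Real.exp (-t ^ 2 / 2)) +
        (L.fading ρ).real {H | ρ ^ A < ∑ i, ∑ j, H i j ^ 2} +
        (L.fading ρ).real (L.shortVectorEvent r ρ ℓ) := by
    have u1 := measureReal_union_le (μ := L.law r ρ) (E₀ ∪ E₁ ∪ E₂) E₃
    have u2 := measureReal_union_le (μ := L.law r ρ) (E₀ ∪ E₁) E₂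
    have u3 := measureReal_union_le (μ := L.law r ρ) E₀ E₁
    linarith
  have hagree : ∀ ω ∉ E₀ ∪ E₁ ∪ E₂ ∪ E₃,
      L.lrDecoder c tie δ ξ N r ρ ω.2.1 (L.received r ρ ω.1 ω.2.1 ω.2.2) =
        some (L.exactDecoder tie r ρ ω.2.1 (L.received r ρ ω.1 ω.2.1 ω.2.2)) := by
    rintro ⟨s, H, w⟩ hω
    simp only [E₀, E₁, E₂, E₃, Set.mem_union, Set.mem_prod, Set.mem_univ, and_true, true_and,
      Set.mem_compl_iff, Set.mem_ofPred_eq, not_or, not_not, not_lt] at hω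
    obtain ⟨⟨⟨hs, hw⟩, hH⟩, hshort⟩ := hω
    obtain ⟨hU, hfl⟩ := hflops H hH hshort
    refine L.lrDecoder_eq r H hρ hU (hfl _) (s := s) ?_
    refine (L.metric_received_le r H hρ s w).trans ?_
    linarith [hK s hs]
  refine le_trans ?_ hbad
  rw [abs_sub_le_iff]
  constructor
  · rw [sub_le_iff_le_add, add_comm]
    refine le_trans (measureReal_mono ?_) (measureReal_union_le _ _)
    intro ω hω
    by_cases hb : ω ∈ E₀ ∪ E₁ ∪ E₂ ∪ E₃
    · exact Or.inr hb
    · refine Or.inl fun heq => hω.out ?_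
      rw [hagree ω hb, heq]
  · rw [sub_le_iff_le_add, add_comm]
    refine le_trans (measureReal_mono ?_) (measureReal_union_le _ _)
    intro ω hω
    by_cases hb : ω ∈ E₀ ∪ E₁ ∪ E₂ ∪ E₃
    · exact Or.inr hb
    · refine Or.inl fun heq => hω.out ?_
      rw [hagree ω hb] at heq
      exact Option.some.inj heq

theorem eventually_fading_large_le (hpow : L.PowerLimited) (A : ℝ) :
    ∀ᶠ ρ : ℝ in atTop,
      (L.fading ρ).real {H | ρ ^ A < ∑ i, ∑ j, H i j ^ 2} ≤ ρ ^ (-(A - 2)) := by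
  filter_upwards [hpow 1 one_pos, eventually_gt_atTop 0] with ρ h hρ
  have := L.fading_prob ρ
  have hA := Real.rpow_pos_of_pos hρ A
  have hmeas : Measurable fun H : Fin n → Fin m → ℝ =>
      ENNReal.ofReal (∑ i, ∑ j, H i j ^ 2) := by fun_prop
  have h1 := (mul_meas_ge_le_lintegral hmeas (μ := L.fading ρ) (ENNReal.ofReal (ρ ^ A))).trans h
  have h2 : {H : Fin n → Fin m → ℝ | ρ ^ A < ∑ i, ∑ j, H i j ^ 2} ⊆
      {H | ENNReal.ofReal (ρ ^ A) ≤ ENNReal.ofReal (∑ i, ∑ j, H i j ^ 2)} := fun H hH =>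
    ENNReal.ofReal_le_ofReal hH.out.le
  have h3 := ENNReal.toReal_mono ENNReal.ofReal_ne_top
    ((mul_le_mul_right (measure_mono h2) (ENNReal.ofReal (ρ ^ A))).trans h1)
  rw [ENNReal.toReal_mul, ENNReal.toReal_ofReal hA.le,
    ENNReal.toReal_ofReal (Real.rpow_nonneg hρ.le _)] at h3
  have h4 : ρ ^ (1 + 1 : ℝ) = ρ ^ A * ρ ^ (-(A - 2)) := by
    rw [← Real.rpow_add hρ]; congr 1; ring
  rw [h4] at h3
  exact le_of_mul_le_mul_left h3 hA

theorem shortVectorEvent_subset {r r' ρ ℓ ℓ' : ℝ} (hρ : 0 < ρ)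
    (h : ρ ^ (2 * (L.scaleExp r - L.scaleExp r')) * ℓ ≤ ℓ') :
    L.shortVectorEvent r ρ ℓ ⊆ L.shortVectorEvent r' ρ ℓ' := by
  rintro H ⟨v, hv, hle⟩
  refine ⟨v, hv, ?_⟩
  refine (L.latticeSq_eq_rpow_mul r r' hρ H v).trans_le ?_
  exact (mul_le_mul_of_nonneg_left hle (Real.rpow_nonneg hρ.le _)).trans h

theorem shortVectorEvent_eq_empty {ρ ℓ : ℝ} (hℓ : ℓ < 1) :
    L.shortVectorEvent 0 ρ ℓ = ∅ := by
  refine Set.eq_empty_of_forall_notMem ?_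
  rintro H ⟨v, hv, hle⟩
  have h1 := one_le_sqNorm_intVec hv
  have h2 := sqNorm_nonneg (L.codeChannel 0 ρ H *ᵥ intVec v)
  have h3 : L.latticeSq 0 ρ H v = sqNorm (L.codeChannel 0 ρ H *ᵥ intVec v) +
      L.alpha 0 ρ ^ 2 * sqNorm (intVec v) := rfl
  have h4 : L.alpha 0 ρ = 1 := by simp [alpha, scaleExp]
  rw [h3, h4] at hle
  linarith

/-- Polynomially short lattice vectors are much less likely than errors: they would cause errors
already at a slightly smaller multiplexing gain, where the diversity gain is larger. -/
theorem exists_tendsto_shortVectorEvent_div (hκ : 0 < κ) {tie : Set (Fin κ → ℤ) → (Fin κ → ℤ)}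
    (htie : ∀ A, A.Nonempty → tie A ∈ A) {r : ℝ} (hr : 0 ≤ r) {d : ℝ → EReal}
    (hd : ∀ r', 0 ≤ r' → r' ≤ r → HasDiversityGain (fun ρ => L.exactError tie r' ρ) (d r'))
    (hdecr : ∀ ε, 0 < ε → ε ≤ r → d r < d (r - ε)) {ε₀ : ℝ} (hε₀ : 0 < ε₀) :
    ∃ ε, 0 < ε ∧ ε ≤ ε₀ ∧ Tendsto (fun ρ : ℝ =>
      (L.fading ρ).real (L.shortVectorEvent r ρ (ρ ^ (-ε))) / L.exactError tie r ρ)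
        atTop (𝓝 0) := by
  rcases hr.eq_or_lt with rfl | hr0
  · refine ⟨ε₀, hε₀, le_rfl, tendsto_const_nhds.congr' ?_⟩
    filter_upwards [eventually_gt_atTop 1] with ρ hρ
    rw [L.shortVectorEvent_eq_empty (Real.rpow_lt_one_of_one_lt_of_neg hρ (neg_neg_of_pos hε₀)),
      measureReal_empty, zero_div]
  obtain ⟨θ, hθ, p, hp, herr⟩ := L.exists_mul_shortVectorEvent_le htie
  have hT : (0 : ℝ) < L.T := by exact_mod_cast L.T_pos
  have hκ' : (0 : ℝ) < κ := by exact_mod_cast hκ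
  set ε := min ε₀ (4 * r * L.T / κ) with hε
  have hε0 : 0 < ε := lt_min hε₀ (by positivity)
  set η := ε * κ / (4 * L.T) with hη
  have hη0 : 0 < η := by positivity
  have hηr : η ≤ r := by
    have : ε ≤ 4 * r * L.T / κ := min_le_right _ _
    rw [le_div_iff₀ hκ'] at this
    rw [hη, div_le_iff₀ (by positivity)]
    linarith
  refine ⟨ε, hε0, min_le_left _ _, ?_⟩
  have hlim := (tendsto_div_zero_of_diversity_lt (hd r hr le_rfl)
    (hd (r - η) (by linarith) (by linarith)) (hdecr η hη0 hηr)).const_mul p⁻¹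
  rw [mul_zero] at hlim
  refine squeeze_zero' ?_ ?_ hlim
  · filter_upwards [(hd r hr le_rfl).1] with ρ hρ
    positivity
  · filter_upwards [(hd r hr le_rfl).1, eventually_gt_atTop 0,
      (tendsto_rpow_neg_atTop (half_pos hε0)).eventually_le_const hθ] with ρ hP hρ hsmall
    have := L.fading_prob ρ
    have hdiff : L.scaleExp r - L.scaleExp (r - η) = ε / 4 := by
      rw [scaleExp, scaleExp, hη]; field_simp; ring
    have hsub : L.shortVectorEvent r ρ (ρ ^ (-ε)) ⊆ L.shortVectorEvent (r - η) ρ θ := by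
      refine L.shortVectorEvent_subset hρ ?_
      rw [hdiff, ← Real.rpow_add hρ]
      refine le_trans (le_of_eq ?_) hsmall
      congr 1; ring
    have h1 := measureReal_mono (μ := L.fading ρ) hsub
    have h2 := herr (r - η) ρ hρ
    rw [← mul_div_assoc]
    refine div_le_div_of_nonneg_right ?_ hP.le
    rw [inv_mul_eq_div, le_div_iff₀ hp]
    nlinarith

/-- With a sufficiently large search radius and any polynomial timeout, the gap to the exact
decoder vanishes. -/
theorem tendsto_lrError_div_exactError (hn : 0 < n) (hκ : 0 < κ) (hpow : L.PowerLimited)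
    {tie : Set (Fin κ → ℤ) → (Fin κ → ℤ)} (htie : ∀ A, A.Nonempty → tie A ∈ A)
    {δ : ℝ} (hδ : 1 / 4 < δ) (hδ1 : δ < 1) {r : ℝ} (hr : 0 ≤ r) {d : ℝ → EReal}
    (hd : ∀ r', 0 ≤ r' → r' ≤ r → HasDiversityGain (fun ρ => L.exactError tie r' ρ) (d r'))
    (hdecr : ∀ ε, 0 < ε → ε ≤ r → d r < d (r - ε)) {d₀ : ℝ} (hd₀ : 0 ≤ d₀) (hdr : d r = d₀)
    {z : ℝ} (hz : 2 * n * (d₀ + 1) < z) (c : FlopCosts) {x : ℝ} (hx : 0 < x) :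
    Tendsto (fun ρ : ℝ =>
      L.lrError c tie δ (searchRadius z ρ) (ρ ^ x) r ρ / L.exactError tie r ρ) atTop (𝓝 1) := by
  have hn' : (0 : ℝ) < n := by exact_mod_cast hn
  have hκ' : (0 : ℝ) < κ := by exact_mod_cast hκ
  have hz0 : 0 < z := lt_of_le_of_lt (by positivity) hz
  have hP := hd r hr le_rfl
  obtain ⟨K, hK⟩ := L.exists_bias_le r
  obtain ⟨ε, hε, hεx, hshort⟩ := L.exists_tendsto_shortVectorEvent_div hκ htie hr hd hdecr
    (ε₀ := x / (2 * κ)) (by positivity)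
  have hεκ : ε * κ ≤ x / 2 := by
    rw [le_div_iff₀ (by positivity)] at hεx
    linarith
  have hnoise : Tendsto (fun ρ : ℝ => n * (2 * Real.exp (K / (2 * n))) *
      (ρ ^ (-(z / (2 * n))) / L.exactError tie r ρ)) atTop (𝓝 0) := by
    have hlt : d r < ((z / (2 * n) : ℝ) : EReal) := by
      rw [hdr]
      have : d₀ < z / (2 * n) := by
        rw [lt_div_iff₀ (by positivity)]; linarith
      exact_mod_cast this
    simpa using (tendsto_div_zero_of_diversity_lt hP (hasDiversityGain_rpow_neg _) hlt).const_mul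
      (n * (2 * Real.exp (K / (2 * n))))
  have hlarge : Tendsto (fun ρ : ℝ => ρ ^ (-((d₀ + 3) - 2)) / L.exactError tie r ρ)
      atTop (𝓝 0) := by
    refine tendsto_div_zero_of_diversity_lt hP (hasDiversityGain_rpow_neg _) ?_
    rw [hdr]
    exact_mod_cast (by linarith : d₀ < d₀ + 3 - 2)
  have hsum := (hnoise.add hlarge).add hshort
  rw [add_zero, add_zero] at hsum
  rw [tendsto_iff_norm_sub_tendsto_zero]
  refine squeeze_zero' (Eventually.of_forall fun _ => norm_nonneg _) ?_ hsum
  filter_upwards [hP.1, eventually_gt_atTop 1, L.eventually_fading_large_le hpow (d₀ + 3),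
    L.eventually_flops_lt hκ hδ hδ1 hr (by linarith : 0 ≤ d₀ + 3) z c hx hε hεκ,
    (Real.tendsto_log_atTop.const_mul_atTop hz0).eventually_ge_atTop K]
    with ρ hPρ hρ hbig hfl hzK
  have hρ0 : 0 < ρ := one_pos.trans hρ
  set t := √((z * Real.log ρ - K) / n) with ht
  have ht2 : t ^ 2 = (z * Real.log ρ - K) / n :=
    Real.sq_sqrt (div_nonneg (by linarith) hn'.le)
  have hξ : searchRadius z ρ ^ 2 = z * Real.log ρ :=
    Real.sq_sqrt (mul_nonneg hz0.le (Real.log_pos hρ).le)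
  have hmain := L.abs_lrError_sub_exactError_le tie (c := c) (N := ρ ^ x) hρ0 (hK ρ hρ0)
    (Real.sqrt_nonneg _ : 0 ≤ t)
    (by rw [hξ, ht2, mul_div_cancel₀ _ hn'.ne']; linarith) hfl
  have hexp : Real.exp (-t ^ 2 / 2) = Real.exp (K / (2 * n)) * ρ ^ (-(z / (2 * n))) := by
    rw [Real.rpow_def_of_pos hρ0, ← Real.exp_add, ht2]
    congr 1
    field_simp
    ring
  rw [hexp] at hmain
  have hnorm : ‖L.lrError c tie δ (searchRadius z ρ) (ρ ^ x) r ρ / L.exactError tie r ρ - 1‖ =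
      |L.lrError c tie δ (searchRadius z ρ) (ρ ^ x) r ρ - L.exactError tie r ρ| /
        L.exactError tie r ρ := by
    rw [Real.norm_eq_abs, div_sub_one hPρ.ne', abs_div, abs_of_pos hPρ]
  have hassoc : n * (2 * (Real.exp (K / (2 * n)) * ρ ^ (-(z / (2 * n))))) =
      n * (2 * Real.exp (K / (2 * n))) * ρ ^ (-(z / (2 * n))) := by ring
  rw [hassoc] at hmain
  rw [hnorm, ← mul_div_assoc, ← add_div, ← add_div]
  refine div_le_div_of_nonneg_right (hmain.trans ?_) hPρ.le
  gcongr

end LatticeLink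

theorem theorem2 (m n κ : ℕ) (hκ : κ = min m n) (L : LatticeLink m n κ)
    (hpow : L.PowerLimited)
    (tie : Set (Fin κ → ℤ) → (Fin κ → ℤ)) (htie : ∀ A, A.Nonempty → tie A ∈ A)
    (δ : ℝ) (hδ : 1 / 4 < δ) (hδ' : δ < 1)
    (r : ℝ) (hr : 0 ≤ r)
    (d : ℝ → EReal)
    (hd : ∀ r', 0 ≤ r' → r' ≤ r → HasDiversityGain (fun ρ => L.exactError tie r' ρ) (d r'))
    (hfin : d r ≠ ⊤)
    (hdecr : ∀ ε, 0 < ε → ε ≤ r → d r < d (r - ε)) :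
    ∃ z₀ : ℝ, d r ≤ (z₀ : EReal) ∧ ∀ z > z₀, ∀ c : FlopCosts,
      (∀ x > (0 : ℝ),
        Tendsto (fun ρ : ℝ =>
            L.lrError c tie δ (searchRadius z ρ) (ρ ^ x) r ρ / L.exactError tie r ρ)
          atTop (𝓝 1)) ∧
      (∀ g ≥ (1 : ℝ),
        IsLeast
          (gapExponents (fun N ρ => L.lrError c tie δ (searchRadius z ρ) N r ρ)
            (fun ρ => L.exactError tie r ρ) g)
          0) := by
  have hP := hd r hr le_rfl
  -- For `κ = 0` there is only one symbol vector, so the exact decoder never errs.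
  have hκ0 : 0 < κ := by
    rcases Nat.eq_zero_or_pos κ with h0 | h0
    · exfalso
      subst h0
      obtain ⟨ρ, hρ⟩ := hP.1.exists
      have hempty : {ω : (Fin 0 → ℤ) × (Fin n → Fin m → ℝ) × (Fin n → ℝ) |
          L.exactDecoder tie r ρ ω.2.1 (L.received r ρ ω.1 ω.2.1 ω.2.2) ≠ ω.1} = ∅ :=
        Set.eq_empty_of_forall_notMem fun ω hω => hω (Subsingleton.elim _ _)
      simp only [LatticeLink.exactError, hempty, measureReal_empty, lt_irrefl] at hρ
    · exact h0
  have hn : 0 < n := by omega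
  have hd0 : 0 ≤ d r := by
    refine nonneg_of_hasDiversityGain hP ?_
    filter_upwards [eventually_gt_atTop 0] with ρ hρ
    have := L.isProbabilityMeasure_law r hρ
    exact measureReal_le_one
  obtain ⟨d₀, hd₀⟩ : ∃ d₀ : ℝ, d r = d₀ :=
    ⟨(d r).toReal, (EReal.coe_toReal hfin (ne_bot_of_le_ne_bot EReal.zero_ne_bot hd0)).symm⟩
  have hd₀0 : 0 ≤ d₀ := by rw [hd₀] at hd0; exact_mod_cast hd0
  have hn1 : (1 : ℝ) ≤ n := by exact_mod_cast hn
  refine ⟨2 * n * (d₀ + 1), ?_, fun z hz c => ?_⟩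
  · rw [hd₀]
    exact_mod_cast (by nlinarith : d₀ ≤ 2 * n * (d₀ + 1))
  have hgap : ∀ x > (0 : ℝ), Tendsto (fun ρ : ℝ =>
      L.lrError c tie δ (searchRadius z ρ) (ρ ^ x) r ρ / L.exactError tie r ρ) atTop (𝓝 1) :=
    fun x hx => L.tendsto_lrError_div_exactError hn hκ0 hpow htie hδ hδ' hr hd hdecr hd₀0 hd₀
      hz c hx
  refine ⟨hgap, fun g hg => ⟨?_, ?_⟩⟩
  · obtain ⟨Nmax, h1, h2, h3⟩ := exists_subpolynomial_policy
      (f := fun N ρ => L.lrError c tie δ (searchRadius z ρ) N r ρ / L.exactError tie r ρ) hgap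
    exact ⟨Nmax, h1, h2, 1, hg, h3⟩
  · rintro e ⟨Nmax, h1, h2, -⟩
    refine ge_of_tendsto h2 ?_
    filter_upwards [h1, eventually_gt_atTop 1] with ρ hN hρ
    exact div_nonneg (Real.log_nonneg hN) (Real.log_pos hρ).le
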